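/- Let $(M^n,g)$ be a smooth connected Riemannian manifold of dimension $n\ge 3$ (possibly with boundary) and let $f\in C^\infty(M)$. Write $\Delta=\nabla^i\nabla_i$ and $$S_f = R+2\Delta f-|\nabla f|^2+\tfrac{1}{n-1}|\nabla f|^2 .$$ For $V\in C^\infty(M)$ put $$F_g^*(V)_{ij}=\nabla_i\nabla_jV-(\Delta V)g_{ij}+\langle\nabla V,\nabla f\rangle g_{ij}-V\Big(\mathrm{Ric}_{ij}+\nabla_i\nabla_jf+\tfrac1{n-1}\nabla_if\,\nabla_jf\Big)+\tfrac12VS_f\,g_{ij},$$ $$F_f^*(V)=2\Delta V-\tfrac{2n}{n-1}\langle\nabla V,\nabla f\rangle-\tfrac{2}{n-1}V\Delta f+\tfrac{2}{n-1}V|\nabla f|^2-VS_f .$$ (Up to the density $e^{-f}dV_g$ these are the two components of the formal adjoint of the linearisation of $(g,f)\mapsto S_f\,e^{-f}dV_g$.) A smooth function $V\not\equiv0$ is called an $f$-static potential for $(g,f)$ if $F_g^*(V)=0$ and $F_f^*(V)=0$. A metric $h$ is called static vacuum with static potential $w$ if $w\in C^\infty(M)$, $w\not\equiv 0$, $\nabla_h^2w=w\,\mathrm{Ric}_h$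 and $\Delta_hw=0$. Set $\widetilde g=e^{-\frac{2f}{n-1}}g$ and, for $V\in C^\infty(M)$, $u=e^{-\frac{f}{n-1}}V$; quantities with a tilde are those of $\widetilde g$. 1. For every $V\in C^\infty(M)$, $$\widetilde\Delta u=e^{\frac{f}{n-1}}\Big(\tfrac12F_f^*(V)+\tfrac12VS_f\Big),\qquad \widetilde\nabla^2u-u\,\widetilde{\mathrm{Ric}}=e^{-\frac{f}{n-1}}\Big(F_g^*(V)+\tfrac12F_f^*(V)\,g\Big),$$ the second being an identity of covariant $2$-tensors. 2. If $V$ is an $f$-static potential for $(g,f)$, then $\widetilde g$ is static vacuum with static potential $u$, and $S_f\equiv0$ on $M$. -/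

import Mathlib

open scoped Manifold ContDiff Matrix
open Bundle

noncomputable section

/-! ### Riemannian geometry in coordinates

Here `s` is a coordinate domain in `ℝⁿ` (relatively open in the model domain, so all derivatives
are taken within `s`) and `G : ℝⁿ → Matrix` is the matrix `(g_ij)` of the metric on `s`. -/

namespace CoordGeom

variable {n : ℕ}

/-- The partial derivative `∂_i w`. -/
def pd (s : Set (EuclideanSpace ℝ (Fin n))) (i : Fin n)
    (w : EuclideanSpace ℝ (Fin n) → ℝ) (y : EuclideanSpace ℝ (Fin n)) : ℝ :=
  fderivWithin ℝ w s y (EuclideanSpace.single i 1)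

/-- The Christoffel symbol
`Γ^k_ij = ½ ∑_l g^{kl} (∂_i g_jl + ∂_j g_il - ∂_l g_ij)` of the Levi-Civita connection. -/
def christoffel (s : Set (EuclideanSpace ℝ (Fin n)))
    (G : EuclideanSpace ℝ (Fin n) → Matrix (Fin n) (Fin n) ℝ) (k i j : Fin n)
    (y : EuclideanSpace ℝ (Fin n)) : ℝ :=
  (1 / 2) * ∑ l, (G y)⁻¹ k l *
    (pd s i (fun z => G z j l) y + pd s j (fun z => G z i l) y - pd s l (fun z => G z i j) y)

/-- The Ricci curvature
`Ric_ij = ∑_k (∂_k Γ^k_ij - ∂_j Γ^k_ik) + ∑_{k,l} (Γ^k_kl Γ^l_ij - Γ^k_jl Γ^l_ik)`. -/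
def ricci (s : Set (EuclideanSpace ℝ (Fin n)))
    (G : EuclideanSpace ℝ (Fin n) → Matrix (Fin n) (Fin n) ℝ) (i j : Fin n)
    (y : EuclideanSpace ℝ (Fin n)) : ℝ :=
  ∑ k, (pd s k (christoffel s G k i j) y - pd s j (christoffel s G k i k) y)
    + ∑ k, ∑ l, (christoffel s G k k l y * christoffel s G l i j y
        - christoffel s G k j l y * christoffel s G l i k y)

/-- The trace `g^{ij} T_ij` of a covariant two-tensor. -/
def tr (G : EuclideanSpace ℝ (Fin n) → Matrix (Fin n) (Fin n) ℝ)
    (T : Fin n → Fin n → EuclideanSpace ℝ (Fin n) → ℝ) (y : EuclideanSpace ℝ (Fin n)) : ℝ :=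
  ∑ i, ∑ j, (G y)⁻¹ i j * T i j y

/-- The scalar curvature `R = g^{ij} Ric_ij`. -/
def scal (s : Set (EuclideanSpace ℝ (Fin n)))
    (G : EuclideanSpace ℝ (Fin n) → Matrix (Fin n) (Fin n) ℝ)
    (y : EuclideanSpace ℝ (Fin n)) : ℝ :=
  tr G (ricci s G) y

/-- The Hessian `∇_i ∇_j w = ∂_i ∂_j w - Γ^k_ij ∂_k w`. -/
def hess (s : Set (EuclideanSpace ℝ (Fin n)))
    (G : EuclideanSpace ℝ (Fin n) → Matrix (Fin n) (Fin n) ℝ)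
    (w : EuclideanSpace ℝ (Fin n) → ℝ) (i j : Fin n) (y : EuclideanSpace ℝ (Fin n)) : ℝ :=
  pd s i (pd s j w) y - ∑ k, christoffel s G k i j y * pd s k w y

/-- The Laplacian `Δ w = g^{ij} ∇_i ∇_j w`. -/
def lap (s : Set (EuclideanSpace ℝ (Fin n)))
    (G : EuclideanSpace ℝ (Fin n) → Matrix (Fin n) (Fin n) ℝ)
    (w : EuclideanSpace ℝ (Fin n) → ℝ) (y : EuclideanSpace ℝ (Fin n)) : ℝ :=
  tr G (hess s G w) y

/-- The inner product of gradients `⟨∇v, ∇w⟩ = g^{ij} ∂_i v ∂_j w`. -/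
def gradInner (s : Set (EuclideanSpace ℝ (Fin n)))
    (G : EuclideanSpace ℝ (Fin n) → Matrix (Fin n) (Fin n) ℝ)
    (v w : EuclideanSpace ℝ (Fin n) → ℝ) (y : EuclideanSpace ℝ (Fin n)) : ℝ :=
  tr G (fun i j z => pd s i v z * pd s j w z) y

/-- The weighted scalar curvature `R_f = R + 2 Δf - |∇f|²`. -/
def weightedScal (s : Set (EuclideanSpace ℝ (Fin n)))
    (G : EuclideanSpace ℝ (Fin n) → Matrix (Fin n) (Fin n) ℝ)
    (f : EuclideanSpace ℝ (Fin n) → ℝ) (y : EuclideanSpace ℝ (Fin n)) : ℝ :=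
  scal s G y + 2 * lap s G f y - gradInner s G f f y

/-- The curvature quantity `S_f = R_f + |∇f|² / (n - 1)`. -/
def Sf (s : Set (EuclideanSpace ℝ (Fin n)))
    (G : EuclideanSpace ℝ (Fin n) → Matrix (Fin n) (Fin n) ℝ)
    (f : EuclideanSpace ℝ (Fin n) → ℝ) (y : EuclideanSpace ℝ (Fin n)) : ℝ :=
  weightedScal s G f y + 1 / ((n : ℝ) - 1) * gradInner s G f f y

/-- The components (indices lowered with `g`) of `F_g^*(V)`: the metric part of the formal adjoint
of the linearisation of `(g, f) ↦ S_f e^{-f} dV_g`, with the density `e^{-f} dV_g` divided out. -/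
def adjG (s : Set (EuclideanSpace ℝ (Fin n)))
    (G : EuclideanSpace ℝ (Fin n) → Matrix (Fin n) (Fin n) ℝ)
    (f V : EuclideanSpace ℝ (Fin n) → ℝ) (i j : Fin n) (y : EuclideanSpace ℝ (Fin n)) : ℝ :=
  hess s G V i j y - lap s G V y * G y i j + gradInner s G V f y * G y i j
    - V y * (ricci s G i j y + hess s G f i j y + 1 / ((n : ℝ) - 1) * (pd s i f y * pd s j f y))
    + 1 / 2 * V y * Sf s G f y * G y i j

/-- `F_f^*(V)`: the weight part of the same formal adjoint, with the density divided out. -/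
def adjF (s : Set (EuclideanSpace ℝ (Fin n)))
    (G : EuclideanSpace ℝ (Fin n) → Matrix (Fin n) (Fin n) ℝ)
    (f V : EuclideanSpace ℝ (Fin n) → ℝ) (y : EuclideanSpace ℝ (Fin n)) : ℝ :=
  2 * lap s G V y - 2 * (n : ℝ) / ((n : ℝ) - 1) * gradInner s G V f y
    - 2 / ((n : ℝ) - 1) * V y * lap s G f y
    + 2 / ((n : ℝ) - 1) * V y * gradInner s G f f y
    - V y * Sf s G f y

end CoordGeom

/-! ### Weighted Riemannian manifolds

The manifold `M` is modelled on `ℝⁿ` through an arbitrary model with corners, so that it may have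
a boundary. -/

section Manifold

variable {n : ℕ} {H : Type*} [TopologicalSpace H]
  {I : ModelWithCorners ℝ (EuclideanSpace ℝ (Fin n)) H}
  {M : Type*} [TopologicalSpace M] [ChartedSpace H M] [IsManifold I ∞ M]

/-- The coordinate domain in `ℝⁿ` of a chart. -/
def chartDomain (I : ModelWithCorners ℝ (EuclideanSpace ℝ (Fin n)) H)
    (φ : OpenPartialHomeomorph M H) : Set (EuclideanSpace ℝ (Fin n)) :=
  (φ.extend I).target

/-- A function on `M` read in a chart. -/
def chartFun (I : ModelWithCorners ℝ (EuclideanSpace ℝ (Fin n)) H)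
    (φ : OpenPartialHomeomorph M H) (w : M → ℝ) (y : EuclideanSpace ℝ (Fin n)) : ℝ :=
  w ((φ.extend I).symm y)

/-- The coordinate vector field `∂_i` of a chart, at the point with coordinates `y`. -/
def coordVec (I : ModelWithCorners ℝ (EuclideanSpace ℝ (Fin n)) H)
    (φ : OpenPartialHomeomorph M H) (i : Fin n) (y : EuclideanSpace ℝ (Fin n)) :
    TangentSpace I ((φ.extend I).symm y) :=
  mfderivWithin 𝓘(ℝ, EuclideanSpace ℝ (Fin n)) I (φ.extend I).symm (chartDomain I φ) y
    (EuclideanSpace.single i (1 : ℝ) : EuclideanSpace ℝ (Fin n))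

/-- A smooth Riemannian metric on `M`. -/
abbrev RiemMetric (I : ModelWithCorners ℝ (EuclideanSpace ℝ (Fin n)) H)
    (M : Type*) [TopologicalSpace M] [ChartedSpace H M] [IsManifold I ∞ M] :=
  ContMDiffRiemannianMetric I ∞ (EuclideanSpace ℝ (Fin n)) (fun x : M => TangentSpace I x)

/-- The matrix `g_ij = g(∂_i, ∂_j)` of a metric in a chart. -/
def chartMetric (g : RiemMetric I M) (φ : OpenPartialHomeomorph M H)
    (y : EuclideanSpace ℝ (Fin n)) : Matrix (Fin n) (Fin n) ℝ :=
  Matrix.of fun i j => g.inner ((φ.extend I).symm y) (coordVec I φ i y) (coordVec I φ j y)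

set_option synthInstance.maxHeartbeats 200000 in
/-- The conformal metric `g̃ = e^{-2f/(n-1)} g`. -/
def weightedConformal (g : RiemMetric I M) (f : C^∞⟮I, M; ℝ⟯) : RiemMetric I M where
  inner x := Real.exp (-(2 * f x / ((n : ℝ) - 1))) • g.inner x
  symm x v w := by
    simp [g.symm x v w]
  pos x v hv := by
    have := g.pos x v hv
    change 0 < Real.exp (-(2 * f x / ((n : ℝ) - 1))) * g.inner x v v
    positivity
  isVonNBounded x := by
    set c := Real.exp (-(2 * f x / ((n : ℝ) - 1))) with hc
    have hc0 : 0 < c := Real.exp_pos _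
    have hs : 0 < Real.sqrt c := Real.sqrt_pos.2 hc0
    have hb := (g.isVonNBounded x).image
      ((Real.sqrt c)⁻¹ • ContinuousLinearMap.id ℝ (TangentSpace I x))
    refine hb.subset ?_
    intro v hv
    refine ⟨Real.sqrt c • v, ?_, ?_⟩
    · have h1 : c * g.inner x v v < 1 := by simpa using hv
      have h2 : Real.sqrt c * (Real.sqrt c * g.inner x v v) = c * g.inner x v v := by
        rw [← mul_assoc, Real.mul_self_sqrt hc0.le]
      simpa [h2] using h1
    · simp [smul_smul, mul_inv_cancel₀ hs.ne']
  contMDiff := by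
    have h : ContMDiff I 𝓘(ℝ, ℝ) ∞ (fun x => Real.exp (-(2 * f x / ((n : ℝ) - 1)))) := by
      have h1 : ContDiff ℝ ∞ (fun t : ℝ => Real.exp (-(2 * t / ((n : ℝ) - 1)))) := by
        fun_prop
      exact h1.contMDiff.comp f.contMDiff
    exact ContMDiff.smul_section (s := fun x => g.inner x) h g.contMDiff

/-- The function `u = e^{-f/(n-1)} V`. -/
def conformalPotential (n : ℕ) (f V : M → ℝ) (x : M) : ℝ :=
  Real.exp (-(f x / ((n : ℝ) - 1))) * V x

/-- `V` is an `f`-static potential for `(g, f)`: a nontrivial smooth function in the kernel of the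
formal adjoint of the linearisation of `(g, f) ↦ S_f e^{-f} dV_g`. The equations are tensorial and
are imposed in every smooth chart. -/
def IsFStaticPotential (g : RiemMetric I M) (f V : M → ℝ) : Prop :=
  ContMDiff I 𝓘(ℝ, ℝ) ∞ V ∧ (∃ x, V x ≠ 0) ∧
  ∀ φ ∈ IsManifold.maximalAtlas I ∞ M, ∀ y ∈ chartDomain I φ,
    (∀ i j, CoordGeom.adjG (chartDomain I φ) (chartMetric g φ)
      (chartFun I φ f) (chartFun I φ V) i j y = 0) ∧
    CoordGeom.adjF (chartDomain I φ) (chartMetric g φ)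
      (chartFun I φ f) (chartFun I φ V) y = 0

/-- `g` is static vacuum with static potential `u`: `u` is a nontrivial smooth function with
`∇² u = u Ric` and `Δ u = 0`. -/
def IsStaticVacuum (g : RiemMetric I M) (u : M → ℝ) : Prop :=
  ContMDiff I 𝓘(ℝ, ℝ) ∞ u ∧ (∃ x, u x ≠ 0) ∧
  ∀ φ ∈ IsManifold.maximalAtlas I ∞ M, ∀ y ∈ chartDomain I φ,
    (∀ i j, CoordGeom.hess (chartDomain I φ) (chartMetric g φ) (chartFun I φ u) i j y
      = chartFun I φ u y * CoordGeom.ricci (chartDomain I φ) (chartMetric g φ) i j y) ∧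
    CoordGeom.lap (chartDomain I φ) (chartMetric g φ) (chartFun I φ u) y = 0

end Manifold

end

/-! Put ψ = f/(n-1), so that g̃ = e^{-2ψ} g and u = e^{-ψ} V. Since R̃ = e^{2ψ} S_f and V S_f e^{-f}
dV_g = u R̃ dV_g̃, the weighted adjoint is the classical static operator of g̃ in other variables.
The two identities are verified through the transformation laws of the connection, the Hessian and
the Ricci tensor (`conformal_christoffel`, `conformal_hess`, `conformal_ricci`). The weight e^{-ψ}
in u is exactly the one that removes the mixed terms dψ ⊗ dV.

For a static potential, tr F_g^*(V) + (n-1)/2 F_f^*(V) = -V S_f / 2 (`tr_adjG_add_adjF`) forces V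
S_f = 0, and the identities then become the static vacuum equations for u. To divide by V, its
nonvanishing set must be dense. Along a segment in a chart the one-jet of u solves a linear ODE, so
it vanishes identically once it vanishes at one point (`eq_zero_of_hessian_eq`). Hence the interior
of {u = 0} is closed, and connectedness makes it empty. Continuity of S_f concludes.

Boundary points need no separate treatment: derivatives are taken within the chart domain, which
lies in the closure of its interior, and the range of the model is convex. -/

namespace CoordGeom

variable {n : ℕ}

/-! ### Calculus of partial derivatives -/

/-- `G` is a smooth nondegenerate symmetric matrix field on the coordinate domain `s`, on which
derivatives are unique and second derivatives commute. -/
structure IsMetricOn (s : Set (EuclideanSpace ℝ (Fin n)))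
    (G : EuclideanSpace ℝ (Fin n) → Matrix (Fin n) (Fin n) ℝ) : Prop where
  uniqueDiffOn : UniqueDiffOn ℝ s
  subset_closure : s ⊆ closure (interior s)
  contDiffOn : ∀ i j, ContDiffOn ℝ ∞ (fun y => G y i j) s
  symm : ∀ y ∈ s, ∀ i j, G y i j = G y j i
  isUnit_det : ∀ y ∈ s, IsUnit (G y).det

section PartialDerivatives

variable {s : Set (EuclideanSpace ℝ (Fin n))} {v w : EuclideanSpace ℝ (Fin n) → ℝ}
  {y : EuclideanSpace ℝ (Fin n)} {i j : Fin n}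

theorem contDiffOn_pd (hs : UniqueDiffOn ℝ s) (hw : ContDiffOn ℝ ∞ w s) (i : Fin n) :
    ContDiffOn ℝ ∞ (pd s i w) s :=
  (hw.fderivWithin hs (m := ∞) (by simp)).clm_apply contDiffOn_const

theorem pd_congr (h : Set.EqOn v w s) (hy : y ∈ s) : pd s i v y = pd s i w y := by
  simp only [pd, fderivWithin_congr h (h hy)]

theorem _root_.ContDiffOn.differentiableWithinAt_of_mem (hw : ContDiffOn ℝ ∞ w s) (hy : y ∈ s) :
    DifferentiableWithinAt ℝ w s y :=
  (hw.differentiableOn (by simp)) y hy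

theorem pd_const (c : ℝ) : pd s i (fun _ => c) y = 0 := by
  simp [pd]

theorem pd_add (hs : UniqueDiffOn ℝ s) (hv : ContDiffOn ℝ ∞ v s) (hw : ContDiffOn ℝ ∞ w s)
    (hy : y ∈ s) : pd s i (fun z => v z + w z) y = pd s i v y + pd s i w y := by
  simp only [pd]
  rw [fderivWithin_fun_add (hs y hy) (hv.differentiableWithinAt_of_mem hy)
    (hw.differentiableWithinAt_of_mem hy)]
  rfl

theorem pd_sub (hs : UniqueDiffOn ℝ s) (hv : ContDiffOn ℝ ∞ v s) (hw : ContDiffOn ℝ ∞ w s)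
    (hy : y ∈ s) : pd s i (fun z => v z - w z) y = pd s i v y - pd s i w y := by
  simp only [pd]
  rw [fderivWithin_fun_sub (hs y hy) (hv.differentiableWithinAt_of_mem hy)
    (hw.differentiableWithinAt_of_mem hy)]
  rfl

theorem pd_mul (hs : UniqueDiffOn ℝ s) (hv : ContDiffOn ℝ ∞ v s) (hw : ContDiffOn ℝ ∞ w s)
    (hy : y ∈ s) : pd s i (fun z => v z * w z) y = pd s i v y * w y + v y * pd s i w y := by
  simp only [pd]
  rw [fderivWithin_fun_mul (hs y hy) (hv.differentiableWithinAt_of_mem hy)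
    (hw.differentiableWithinAt_of_mem hy)]
  simp only [add_apply, smul_apply, smul_eq_mul]
  ring

theorem pd_const_mul (hs : UniqueDiffOn ℝ s) (c : ℝ) (hw : ContDiffOn ℝ ∞ w s)
    (hy : y ∈ s) : pd s i (fun z => c * w z) y = c * pd s i w y := by
  rw [pd_mul hs contDiffOn_const hw hy, pd_const]; ring

theorem pd_sum (hs : UniqueDiffOn ℝ s) {ι : Type*} {t : Finset ι}
    {a : ι → EuclideanSpace ℝ (Fin n) → ℝ}
    (ha : ∀ k ∈ t, ContDiffOn ℝ ∞ (a k) s) (hy : y ∈ s) :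
    pd s i (fun z => ∑ k ∈ t, a k z) y = ∑ k ∈ t, pd s i (a k) y := by
  simp only [pd]
  rw [fderivWithin_fun_sum (hs y hy) fun k hk => (ha k hk).differentiableWithinAt_of_mem hy]
  simp

theorem pd_exp (hs : UniqueDiffOn ℝ s) (hw : ContDiffOn ℝ ∞ w s) (hy : y ∈ s) :
    pd s i (fun z => Real.exp (w z)) y = Real.exp (w y) * pd s i w y := by
  simp only [pd]
  rw [((hw.differentiableWithinAt_of_mem hy).hasFDerivWithinAt.exp).fderivWithin (hs y hy)]
  rfl

/-- At a boundary point the symmetry of second derivatives is inherited from nearby interior points;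
this is the role of `hs'`. -/
theorem pd_comm (hs : UniqueDiffOn ℝ s) (hs' : s ⊆ closure (interior s))
    (hw : ContDiffOn ℝ ∞ w s) (hy : y ∈ s) :
    pd s i (pd s j w) y = pd s j (pd s i w) y := by
  have hd : DifferentiableWithinAt ℝ (fderivWithin ℝ w s) s y :=
    ((hw.fderivWithin hs (m := ∞) (by simp)).differentiableOn (by simp)) y hy
  have key : ∀ a b : Fin n, pd s a (pd s b w) y
      = fderivWithin ℝ (fderivWithin ℝ w s) s y (EuclideanSpace.single a 1)
        (EuclideanSpace.single b 1) := by
    intro a b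
    change fderivWithin ℝ (fun z => fderivWithin ℝ w s z (EuclideanSpace.single b 1)) s y _ = _
    rw [fderivWithin_clm_apply (hs y hy) hd (differentiableWithinAt_const _)]
    simp
  rw [key, key]
  exact (hw y hy).isSymmSndFDerivWithinAt
    (by simpa using WithTop.coe_le_coe.2 (le_top : (2 : ℕ∞) ≤ ⊤)) hs (hs' hy) hy _ _

end PartialDerivatives

/-! ### Smoothness of the geometric quantities -/

section Smoothness

variable {s : Set (EuclideanSpace ℝ (Fin n))}
  {G : EuclideanSpace ℝ (Fin n) → Matrix (Fin n) (Fin n) ℝ}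
  {v w : EuclideanSpace ℝ (Fin n) → ℝ} {y : EuclideanSpace ℝ (Fin n)}

theorem contDiffOn_det {A : EuclideanSpace ℝ (Fin n) → Matrix (Fin n) (Fin n) ℝ}
    (hA : ∀ i j, ContDiffOn ℝ ∞ (fun y => A y i j) s) :
    ContDiffOn ℝ ∞ (fun y => (A y).det) s := by
  simp only [Matrix.det_apply, Units.smul_def, zsmul_eq_mul]
  exact ContDiffOn.sum fun σ _ => contDiffOn_const.mul (contDiffOn_prod fun i _ => hA _ _)

namespace IsMetricOn

/-- Cramer's rule: the determinant and the adjugate are polynomial in the entries, and the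
determinant does not vanish on `s`. -/
theorem contDiffOn_inv (hG : IsMetricOn s G) (i j : Fin n) :
    ContDiffOn ℝ ∞ (fun y => (G y)⁻¹ i j) s := by
  have hdet := contDiffOn_det hG.contDiffOn
  have hadj : ContDiffOn ℝ ∞ (fun y => (G y).adjugate i j) s := by
    simp only [Matrix.adjugate_apply]
    refine contDiffOn_det fun a b => ?_
    by_cases h : a = j
    · simp only [h, Matrix.updateRow_self]; exact contDiffOn_const
    · simp only [Matrix.updateRow_ne h]; exact hG.contDiffOn a b
  have : (fun y => (G y)⁻¹ i j) = fun y => (G y).det⁻¹ * (G y).adjugate i j := by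
    funext y; simp [Matrix.inv_def]
  rw [this]
  exact (hdet.inv fun y hy => (hG.isUnit_det y hy).ne_zero).mul hadj

theorem inv_symm (hG : IsMetricOn s G) (hy : y ∈ s) (i j : Fin n) :
    (G y)⁻¹ i j = (G y)⁻¹ j i := by
  have h : (G y)ᵀ = G y := by ext a b; exact hG.symm y hy b a
  conv_lhs => rw [← h, ← Matrix.transpose_nonsing_inv]
  rfl

theorem sum_inv_mul (hG : IsMetricOn s G) (hy : y ∈ s) (i j : Fin n) :
    ∑ k, (G y)⁻¹ i k * G y k j = if i = j then 1 else 0 := by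
  rw [← Matrix.mul_apply, Matrix.nonsing_inv_mul _ (hG.isUnit_det y hy), Matrix.one_apply]

theorem sum_mul_inv (hG : IsMetricOn s G) (hy : y ∈ s) (i j : Fin n) :
    ∑ k, G y i k * (G y)⁻¹ k j = if i = j then 1 else 0 := by
  rw [← Matrix.mul_apply, Matrix.mul_nonsing_inv _ (hG.isUnit_det y hy), Matrix.one_apply]

theorem contDiffOn_christoffel (hG : IsMetricOn s G) (k i j : Fin n) :
    ContDiffOn ℝ ∞ (christoffel s G k i j) s := by
  have hpd : ∀ a b c, ContDiffOn ℝ ∞ (pd s a (fun z => G z b c)) s :=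
    fun a b c => contDiffOn_pd hG.uniqueDiffOn (hG.contDiffOn b c) a
  exact contDiffOn_const.mul (ContDiffOn.sum fun l _ => (hG.contDiffOn_inv k l).mul
    (((hpd _ _ _).add (hpd _ _ _)).sub (hpd _ _ _)))

theorem contDiffOn_ricci (hG : IsMetricOn s G) (i j : Fin n) :
    ContDiffOn ℝ ∞ (ricci s G i j) s := by
  have h := hG.contDiffOn_christoffel
  exact (ContDiffOn.sum fun k _ => (contDiffOn_pd hG.uniqueDiffOn (h _ _ _) k).sub
    (contDiffOn_pd hG.uniqueDiffOn (h _ _ _) j)).add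
    (ContDiffOn.sum fun k _ => ContDiffOn.sum fun l _ =>
      ((h _ _ _).mul (h _ _ _)).sub ((h _ _ _).mul (h _ _ _)))

theorem contDiffOn_tr (hG : IsMetricOn s G) {T : Fin n → Fin n → EuclideanSpace ℝ (Fin n) → ℝ}
    (hT : ∀ i j, ContDiffOn ℝ ∞ (T i j) s) : ContDiffOn ℝ ∞ (tr G T) s :=
  ContDiffOn.sum fun i _ => ContDiffOn.sum fun j _ => (hG.contDiffOn_inv i j).mul (hT i j)

theorem contDiffOn_hess (hG : IsMetricOn s G) (hw : ContDiffOn ℝ ∞ w s) (i j : Fin n) :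
    ContDiffOn ℝ ∞ (hess s G w i j) s :=
  (contDiffOn_pd hG.uniqueDiffOn (contDiffOn_pd hG.uniqueDiffOn hw j) i).sub
    (ContDiffOn.sum fun k _ =>
    (hG.contDiffOn_christoffel k i j).mul (contDiffOn_pd hG.uniqueDiffOn hw k))

theorem contDiffOn_Sf (hG : IsMetricOn s G) (hw : ContDiffOn ℝ ∞ w s) :
    ContDiffOn ℝ ∞ (Sf s G w) s := by
  have h1 : ContDiffOn ℝ ∞ (scal s G) s := hG.contDiffOn_tr hG.contDiffOn_ricci
  have h2 : ContDiffOn ℝ ∞ (lap s G w) s := hG.contDiffOn_tr (hG.contDiffOn_hess hw)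
  have h3 : ContDiffOn ℝ ∞ (gradInner s G w w) s := hG.contDiffOn_tr fun i j =>
    (contDiffOn_pd hG.uniqueDiffOn hw i).mul (contDiffOn_pd hG.uniqueDiffOn hw j)
  exact ((h1.add (contDiffOn_const.mul h2)).sub h3).add (contDiffOn_const.mul h3)

/-! ### Symmetry and metric compatibility of the connection -/

theorem christoffel_symm (hG : IsMetricOn s G) (hy : y ∈ s) (k i j : Fin n) :
    christoffel s G k i j y = christoffel s G k j i y := by
  have h : ∀ l, pd s l (fun z => G z i j) y = pd s l (fun z => G z j i) y :=
    fun l => pd_congr (fun z hz => hG.symm z hz i j) hy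
  simp only [christoffel, h]
  congr 1
  exact Finset.sum_congr rfl fun l _ => by ring

/-- The Christoffel symbols of the first kind. -/
theorem sum_mul_christoffel (hG : IsMetricOn s G) (hy : y ∈ s) (l i j : Fin n) :
    ∑ k, G y l k * christoffel s G k i j y = 1 / 2 * (pd s i (fun z => G z j l) y
      + pd s j (fun z => G z i l) y - pd s l (fun z => G z i j) y) := by
  simp only [christoffel, Finset.mul_sum]
  rw [Finset.sum_comm]
  have h : ∀ m, ∑ k, G y l k * (1 / 2 * ((G y)⁻¹ k m * (pd s i (fun z => G z j m) y
      + pd s j (fun z => G z i m) y - pd s m (fun z => G z i j) y)))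
      = (∑ k, G y l k * (G y)⁻¹ k m) * (1 / 2 * (pd s i (fun z => G z j m) y
      + pd s j (fun z => G z i m) y - pd s m (fun z => G z i j) y)) := by
    intro m
    rw [Finset.sum_mul]
    exact Finset.sum_congr rfl fun k _ => by ring
  simp only [h, hG.sum_mul_inv hy, ite_mul, one_mul, zero_mul, Finset.sum_ite_eq,
    Finset.mem_univ, if_true]

/-- The metric is parallel. -/
theorem pd_metric (hG : IsMetricOn s G) (hy : y ∈ s) (c i j : Fin n) :
    pd s c (fun z => G z i j) y = (∑ k, G y j k * christoffel s G k c i y)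
      + ∑ k, G y i k * christoffel s G k c j y := by
  have h : ∀ l a b, pd s l (fun z => G z a b) y = pd s l (fun z => G z b a) y :=
    fun l a b => pd_congr (fun z hz => hG.symm z hz a b) hy
  rw [hG.sum_mul_christoffel hy, hG.sum_mul_christoffel hy, h i c j, h j c i, h c j i]
  ring

/-- The inverse metric is parallel. -/
theorem pd_inv_metric (hG : IsMetricOn s G) (hy : y ∈ s) (c i j : Fin n) :
    pd s c (fun z => (G z)⁻¹ i j) y = -(∑ k, (G y)⁻¹ j k * christoffel s G i c k y)
      - ∑ k, (G y)⁻¹ i k * christoffel s G j c k y := by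
  set A : Matrix (Fin n) (Fin n) ℝ := Matrix.of fun a b => pd s c (fun z => G z a b) y with hA
  set B : Matrix (Fin n) (Fin n) ℝ := Matrix.of fun a b => pd s c (fun z => (G z)⁻¹ a b) y with hB
  set C : Matrix (Fin n) (Fin n) ℝ := Matrix.of fun a b => christoffel s G a c b y with hC
  have hu := hG.isUnit_det y hy
  have hGt : (G y)ᵀ = G y := by ext a b; exact hG.symm y hy b a
  have h1 : A = (G y * C)ᵀ + G y * C := by
    ext a b
    simp only [hA, Matrix.of_apply, hG.pd_metric hy, Matrix.add_apply, Matrix.transpose_apply,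
      Matrix.mul_apply, hC]
  -- Differentiate G⁻¹ G = 1; solving for `B` and inserting `h1` gives the formula in matrix form.
  have h2 : B * G y + (G y)⁻¹ * A = 0 := by
    ext a b
    have := pd_congr (i := c) (fun z hz => hG.sum_inv_mul hz a b) hy
    rw [pd_const, pd_sum hG.uniqueDiffOn
      (fun k _ => (hG.contDiffOn_inv a k).mul (hG.contDiffOn k b)) hy] at this
    simp only [pd_mul hG.uniqueDiffOn (hG.contDiffOn_inv a _) (hG.contDiffOn _ b) hy,
      Finset.sum_add_distrib] at this
    simpa [Matrix.mul_apply, hA, hB] using this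
  have h3 : B = -((G y)⁻¹ * Cᵀ) - C * (G y)⁻¹ := by
    calc B = B * G y * (G y)⁻¹ := by rw [Matrix.mul_nonsing_inv_cancel_right _ _ hu]
      _ = -((G y)⁻¹ * A) * (G y)⁻¹ := by rw [eq_neg_of_add_eq_zero_left h2]
      _ = -((G y)⁻¹ * (Cᵀ * G y * (G y)⁻¹)) - ((G y)⁻¹ * G y) * C * (G y)⁻¹ := by
        rw [h1, Matrix.transpose_mul, hGt]; noncomm_ring
      _ = _ := by rw [Matrix.mul_nonsing_inv_cancel_right _ _ hu, Matrix.nonsing_inv_mul _ hu,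
        Matrix.one_mul]
  have h4 := congrFun (congrFun h3 i) j
  simp only [hB, hC, Matrix.of_apply, Matrix.sub_apply, Matrix.neg_apply, Matrix.mul_apply,
    Matrix.transpose_apply] at h4
  rw [h4, sub_eq_add_neg, sub_eq_add_neg, add_comm]
  congr 2
  exact Finset.sum_congr rfl fun k _ => by rw [hG.inv_symm hy k j, mul_comm]

end IsMetricOn

end Smoothness
/-! ### Conformal change of the metric -/

/-- The difference `Γ̃ - Γ` of Christoffel symbols under `g̃ = e^{-2ψ} g`, in terms of the metric
`g`, the differential `p = dψ` and the gradient `P = ∇ψ`. -/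
def conformalTensor (g : Fin n → Fin n → ℝ) (p P : Fin n → ℝ) (k i j : Fin n) : ℝ :=
  g i j * P k - (if k = j then p i else 0) - (if k = i then p j else 0)

/-! ### Pointwise algebra of the difference tensor -/

section Algebra

variable {g : Fin n → Fin n → ℝ} {p P : Fin n → ℝ}

theorem sum_mul_conformalTensor (x : Fin n → ℝ) (i j : Fin n) :
    ∑ k, x k * conformalTensor g p P k i j
      = g i j * ∑ k, x k * P k - x j * p i - x i * p j := by
  simp only [conformalTensor, mul_sub, Finset.sum_sub_distrib, mul_ite, mul_zero,
    Finset.sum_ite_eq', Finset.mem_univ, if_true, Finset.mul_sum]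
  congr 2
  exact Finset.sum_congr rfl fun k _ => by ring

/-- Agrees with Γ^k_ik = ∂_i log √det g, as det g is multiplied by e^{-2nψ}. -/
theorem sum_conformalTensor (hP : ∀ i, ∑ k, g i k * P k = p i) (i : Fin n) :
    ∑ k, conformalTensor g p P k i k = -(n * p i) := by
  simp [conformalTensor, Finset.sum_sub_distrib, hP]

theorem conformalTensor_symm (hg : ∀ i j, g i j = g j i) (k i j : Fin n) :
    conformalTensor g p P k i j = conformalTensor g p P k j i := by
  simp only [conformalTensor, hg i j]; ring

theorem sum_sum_mul_conformalTensor_contract (Γ : Fin n → Fin n → Fin n → ℝ) (i j : Fin n) :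
    ∑ k, ∑ l, Γ k k l * conformalTensor g p P l i j
      = g i j * (∑ k, ∑ l, Γ k k l * P l) - (∑ k, Γ k k j) * p i - (∑ k, Γ k k i) * p j := by
  simp only [sum_mul_conformalTensor, Finset.sum_sub_distrib, Finset.mul_sum, Finset.sum_mul]

theorem sum_sum_conformalTensor_contract_mul (hg : ∀ i j, g i j = g j i)
    (hP : ∀ i, ∑ k, g i k * P k = p i) (x : Fin n → ℝ) :
    ∑ k, ∑ l, conformalTensor g p P k k l * x l = -(n * ∑ l, p l * x l) := by
  rw [Finset.sum_comm, Finset.mul_sum, ← Finset.sum_neg_distrib]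
  refine Finset.sum_congr rfl fun l _ => ?_
  rw [← Finset.sum_mul, Finset.sum_congr rfl fun k _ => conformalTensor_symm hg k k l,
    sum_conformalTensor hP]
  ring

/-- The lowered symbol ∑_k g_ik Γ^k_jl is kept as a unit because it later cancels against the
derivative of the metric. -/
theorem sum_sum_mul_conformalTensor (Γ : Fin n → Fin n → Fin n → ℝ) (i j : Fin n) :
    ∑ k, ∑ l, Γ k j l * conformalTensor g p P l i k
      = (∑ l, (∑ k, g i k * Γ k j l) * P l) - (∑ k, Γ k j k) * p i - ∑ k, Γ k j i * p k := by
  simp only [sum_mul_conformalTensor, Finset.sum_sub_distrib, Finset.sum_mul]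
  congr 2
  rw [Finset.sum_comm]
  refine Finset.sum_congr rfl fun k _ => ?_
  rw [Finset.mul_sum]
  exact Finset.sum_congr rfl fun l _ => by ring

theorem sum_sum_conformalTensor_mul (Γ : Fin n → Fin n → Fin n → ℝ) (i j : Fin n) :
    ∑ k, ∑ l, conformalTensor g p P k j l * Γ l i k
      = (∑ l, (∑ k, g j k * Γ k i l) * P l) - (∑ k, Γ k i k) * p j - ∑ k, Γ k i j * p k := by
  rw [← sum_sum_mul_conformalTensor, Finset.sum_comm]
  exact Finset.sum_congr rfl fun k _ => Finset.sum_congr rfl fun l _ => mul_comm _ _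

theorem sum_sum_conformalTensor_mul_self (hg : ∀ i j, g i j = g j i)
    (hP : ∀ i, ∑ k, g i k * P k = p i) (i j : Fin n) :
    ∑ k, ∑ l, conformalTensor g p P k j l * conformalTensor g p P l i k
      = (n + 2) * (p i * p j) - 2 * (g i j * ∑ k, p k * P k) := by
  have h1 : ∀ l, ∑ k, g i k * conformalTensor g p P k j l
      = g j l * p i - g i l * p j - g i j * p l := by
    intro l; rw [sum_mul_conformalTensor, hP]
  have h2 : ∑ k, conformalTensor g p P k j i * p k
      = g j i * ∑ k, p k * P k - p i * p j - p j * p i := by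
    rw [← sum_mul_conformalTensor]
    exact Finset.sum_congr rfl fun k _ => mul_comm _ _
  have h3 : ∑ l, (g j l * p i - g i l * p j - g i j * p l) * P l
      = p i * (∑ l, g j l * P l) - p j * (∑ l, g i l * P l) - g i j * ∑ l, p l * P l := by
    simp only [Finset.mul_sum, ← Finset.sum_sub_distrib]
    exact Finset.sum_congr rfl fun k _ => by ring
  rw [sum_sum_mul_conformalTensor]
  simp only [h1, h2, h3, hP, sum_conformalTensor hP, hg j i]
  ring

/-- The algebraic part of the conformal transformation of the Ricci tensor. -/
theorem sum_christoffel_add_conformalTensor (hg : ∀ i j, g i j = g j i)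
    (hP : ∀ i, ∑ k, g i k * P k = p i) {Γ : Fin n → Fin n → Fin n → ℝ}
    (hΓ : ∀ k i j, Γ k i j = Γ k j i) (i j : Fin n) :
    ∑ k, ∑ l, ((Γ k k l + conformalTensor g p P k k l) * (Γ l i j + conformalTensor g p P l i j)
        - (Γ k j l + conformalTensor g p P k j l) * (Γ l i k + conformalTensor g p P l i k))
      = ∑ k, ∑ l, (Γ k k l * Γ l i j - Γ k j l * Γ l i k)
        + g i j * (∑ k, ∑ l, Γ k k l * P l) - ((n : ℝ) - 2) * ∑ k, Γ k i j * p k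
        - ∑ l, (∑ k, g i k * Γ k j l) * P l - ∑ l, (∑ k, g j k * Γ k i l) * P l
        + ((n : ℝ) - 2) * (p i * p j - g i j * ∑ k, p k * P k) := by
  have e : ∀ k l, (Γ k k l + conformalTensor g p P k k l) * (Γ l i j + conformalTensor g p P l i j)
        - (Γ k j l + conformalTensor g p P k j l) * (Γ l i k + conformalTensor g p P l i k)
      = (Γ k k l * Γ l i j - Γ k j l * Γ l i k) + Γ k k l * conformalTensor g p P l i j
        + conformalTensor g p P k k l * Γ l i j
        + conformalTensor g p P k k l * conformalTensor g p P l i j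
        - Γ k j l * conformalTensor g p P l i k - conformalTensor g p P k j l * Γ l i k
        - conformalTensor g p P k j l * conformalTensor g p P l i k := by intros; ring
  -- The two contractions of Γ agree, so all terms pairing the trace of Γ with p cancel.
  have h1 : ∀ a, ∑ k, Γ k k a = ∑ k, Γ k a k := fun a =>
    Finset.sum_congr rfl fun k _ => hΓ k k a
  have h2 : ∑ k, Γ k j i * p k = ∑ k, Γ k i j * p k :=
    Finset.sum_congr rfl fun k _ => by rw [hΓ]
  have h3 : ∑ k, p k * Γ k i j = ∑ k, Γ k i j * p k :=
    Finset.sum_congr rfl fun k _ => mul_comm _ _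
  simp only [e]
  simp only [Finset.sum_add_distrib, Finset.sum_sub_distrib]
  rw [sum_sum_mul_conformalTensor_contract,
    sum_sum_conformalTensor_contract_mul hg hP (fun l => Γ l i j),
    sum_sum_conformalTensor_contract_mul hg hP (fun l => conformalTensor g p P l i j),
    sum_sum_mul_conformalTensor, sum_sum_conformalTensor_mul,
    sum_sum_conformalTensor_mul_self hg hP, sum_mul_conformalTensor, h1, h1, h2, h3]
  ring

end Algebra

/-- The components `∇^k w = g^{kl} ∂_l w` of the gradient. -/
noncomputable def grad (s : Set (EuclideanSpace ℝ (Fin n)))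
    (G : EuclideanSpace ℝ (Fin n) → Matrix (Fin n) (Fin n) ℝ)
    (w : EuclideanSpace ℝ (Fin n) → ℝ) (k : Fin n) (y : EuclideanSpace ℝ (Fin n)) : ℝ :=
  ∑ l, (G y)⁻¹ k l * pd s l w y

/-! ### Traces, gradients and the conformal transformation laws -/

section Geometry

variable {s : Set (EuclideanSpace ℝ (Fin n))}
  {G Gt : EuclideanSpace ℝ (Fin n) → Matrix (Fin n) (Fin n) ℝ}
  {f V v w ψ : EuclideanSpace ℝ (Fin n) → ℝ} {y : EuclideanSpace ℝ (Fin n)}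

theorem tr_add (T S : Fin n → Fin n → EuclideanSpace ℝ (Fin n) → ℝ) :
    tr G (fun i j z => T i j z + S i j z) y = tr G T y + tr G S y := by
  simp only [tr, mul_add, Finset.sum_add_distrib]

theorem tr_sub (T S : Fin n → Fin n → EuclideanSpace ℝ (Fin n) → ℝ) :
    tr G (fun i j z => T i j z - S i j z) y = tr G T y - tr G S y := by
  simp only [tr, mul_sub, Finset.sum_sub_distrib]

theorem tr_mul_left (a : EuclideanSpace ℝ (Fin n) → ℝ)
    (T : Fin n → Fin n → EuclideanSpace ℝ (Fin n) → ℝ) :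
    tr G (fun i j z => a z * T i j z) y = a y * tr G T y := by
  simp only [tr, Finset.mul_sum]
  exact Finset.sum_congr rfl fun i _ => Finset.sum_congr rfl fun j _ => by ring

theorem tr_congr {T S : Fin n → Fin n → EuclideanSpace ℝ (Fin n) → ℝ}
    (h : ∀ i j, T i j y = S i j y) : tr G T y = tr G S y := by
  simp only [tr, h]

namespace IsMetricOn

theorem tr_metric (hG : IsMetricOn s G) (hy : y ∈ s) : tr G (fun i j z => G z i j) y = n := by
  have : ∀ i, ∑ j, (G y)⁻¹ i j * G y i j = 1 := fun i => by
    simpa [hG.symm y hy i] using hG.sum_inv_mul hy i i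
  simp [tr, this]

theorem contDiffOn_grad (hG : IsMetricOn s G) (hw : ContDiffOn ℝ ∞ w s) (k : Fin n) :
    ContDiffOn ℝ ∞ (grad s G w k) s :=
  ContDiffOn.sum fun l _ => (hG.contDiffOn_inv k l).mul (contDiffOn_pd hG.uniqueDiffOn hw l)

theorem sum_mul_grad (hG : IsMetricOn s G) (hy : y ∈ s) (i : Fin n) :
    ∑ k, G y i k * grad s G w k y = pd s i w y := by
  simp only [grad, Finset.mul_sum, ← mul_assoc]
  rw [Finset.sum_comm]
  simp only [← Finset.sum_mul, hG.sum_mul_inv hy]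
  simp

theorem gradInner_eq_sum_grad :
    gradInner s G v w y = ∑ k, pd s k v y * grad s G w k y := by
  simp only [gradInner, tr, grad, Finset.mul_sum]
  exact Finset.sum_congr rfl fun i _ => Finset.sum_congr rfl fun j _ => by ring

/-- The Laplacian as the divergence of the gradient. -/
theorem lap_eq_divergence (hG : IsMetricOn s G) (hw : ContDiffOn ℝ ∞ w s) (hy : y ∈ s) :
    lap s G w y = ∑ k, pd s k (grad s G w k) y
      + ∑ k, ∑ l, christoffel s G k k l y * grad s G w l y := by
  -- Product rule with a parallel inverse metric. After summation over k, the first correction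
  -- cancels the trace term Γ^k_kl ∇^l w and the second is the connection term of the Hessian.
  have hpd : ∀ k, pd s k (grad s G w k) y = ∑ l, (G y)⁻¹ k l * pd s k (pd s l w) y
      - ∑ l, ∑ m, (G y)⁻¹ l m * christoffel s G k k m y * pd s l w y
      - ∑ l, ∑ m, (G y)⁻¹ k m * (christoffel s G l k m y * pd s l w y) := by
    intro k
    unfold grad
    rw [pd_sum hG.uniqueDiffOn (fun l _ => (hG.contDiffOn_inv k l).mul
      (contDiffOn_pd hG.uniqueDiffOn hw l)) hy, ← Finset.sum_sub_distrib, ← Finset.sum_sub_distrib]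
    refine Finset.sum_congr rfl fun l _ => ?_
    rw [pd_mul hG.uniqueDiffOn (hG.contDiffOn_inv k l) (contDiffOn_pd hG.uniqueDiffOn hw l) hy,
      hG.pd_inv_metric hy]
    simp only [sub_mul, neg_mul, Finset.sum_mul, mul_assoc]
    ring
  have h1 : ∀ k, ∑ l, ∑ m, (G y)⁻¹ l m * christoffel s G k k m y * pd s l w y
      = ∑ l, christoffel s G k k l y * grad s G w l y := by
    intro k
    rw [Finset.sum_comm]
    refine Finset.sum_congr rfl fun m _ => ?_
    rw [grad, Finset.mul_sum]
    exact Finset.sum_congr rfl fun l _ => by rw [hG.inv_symm hy]; ring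
  have h2 : ∀ k, ∑ l, ∑ m, (G y)⁻¹ k m * (christoffel s G l k m y * pd s l w y)
      = ∑ m, (G y)⁻¹ k m * ∑ l, christoffel s G l k m y * pd s l w y := by
    intro k
    rw [Finset.sum_comm]
    simp only [Finset.mul_sum]
  simp only [hpd, h1, h2, lap, tr, hess, mul_sub, Finset.sum_sub_distrib]
  ring

theorem conformal_inv (hG : IsMetricOn s G) (hGt : ∀ z ∈ s, Gt z = Real.exp (-(2 * ψ z)) • G z)
    (hy : y ∈ s) (i j : Fin n) : (Gt y)⁻¹ i j = Real.exp (2 * ψ y) * (G y)⁻¹ i j := by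
  have h : (Gt y)⁻¹ = Real.exp (2 * ψ y) • (G y)⁻¹ := by
    refine Matrix.inv_eq_right_inv ?_
    rw [hGt y hy, Matrix.smul_mul, Matrix.mul_smul, smul_smul, ← Real.exp_add,
      Matrix.mul_nonsing_inv _ (hG.isUnit_det y hy)]
    simp
  rw [h]; rfl

theorem conformal (hG : IsMetricOn s G) (hψ : ContDiffOn ℝ ∞ ψ s)
    (hGt : ∀ z ∈ s, Gt z = Real.exp (-(2 * ψ z)) • G z) : IsMetricOn s Gt where
  uniqueDiffOn := hG.uniqueDiffOn
  subset_closure := hG.subset_closure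
  contDiffOn i j := ((contDiffOn_const.mul hψ).neg.exp.mul (hG.contDiffOn i j)).congr fun z hz => by
    rw [hGt z hz]; rfl
  symm z hz i j := by simp [hGt z hz, hG.symm z hz i j]
  isUnit_det z hz := by
    rw [hGt z hz, Matrix.det_smul]
    exact (IsUnit.mk0 _ (pow_ne_zero _ (Real.exp_ne_zero _))).mul (hG.isUnit_det z hz)

theorem conformal_tr (hG : IsMetricOn s G) (hGt : ∀ z ∈ s, Gt z = Real.exp (-(2 * ψ z)) • G z)
    (hy : y ∈ s) (T : Fin n → Fin n → EuclideanSpace ℝ (Fin n) → ℝ) :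
    tr Gt T y = Real.exp (2 * ψ y) * tr G T y := by
  simp only [tr, hG.conformal_inv hGt hy, Finset.mul_sum, mul_assoc]

/-- Differentiating the factor adds -2 dψ ⊗ g to each derivative of the metric, while the factors of
g̃ and of its inverse cancel. Contraction with g⁻¹ turns one of the three added terms into a
gradient and the other two into Kronecker deltas. -/
theorem conformal_christoffel (hG : IsMetricOn s G) (hψ : ContDiffOn ℝ ∞ ψ s)
    (hGt : ∀ z ∈ s, Gt z = Real.exp (-(2 * ψ z)) • G z) (hy : y ∈ s) (k i j : Fin n) :
    christoffel s Gt k i j y = christoffel s G k i j y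
      + conformalTensor (G y) (fun a => pd s a ψ y) (fun a => grad s G ψ a y) k i j := by
  have hpd : ∀ a b c, pd s a (fun z => Gt z b c) y = Real.exp (-(2 * ψ y)) *
      (pd s a (fun z => G z b c) y - 2 * (pd s a ψ y * G y b c)) := by
    intro a b c
    rw [pd_congr (w := fun z => Real.exp (-2 * ψ z) * G z b c)
      (fun z hz => by simp [hGt z hz]) hy,
      pd_mul hG.uniqueDiffOn (contDiffOn_const.mul hψ).exp (hG.contDiffOn b c) hy,
      pd_exp hG.uniqueDiffOn (contDiffOn_const.mul hψ) hy,
      pd_const_mul hG.uniqueDiffOn _ hψ hy, neg_mul]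
    ring
  have hexp : Real.exp (2 * ψ y) * Real.exp (-(2 * ψ y)) = 1 := by
    rw [← Real.exp_add]; simp
  have hterm : ∀ l, (Gt y)⁻¹ k l * (pd s i (fun z => Gt z j l) y + pd s j (fun z => Gt z i l) y
      - pd s l (fun z => Gt z i j) y)
      = (G y)⁻¹ k l * (pd s i (fun z => G z j l) y + pd s j (fun z => G z i l) y
        - pd s l (fun z => G z i j) y)
        + 2 * G y i j * ((G y)⁻¹ k l * pd s l ψ y)
        - 2 * pd s i ψ y * ((G y)⁻¹ k l * G y l j) - 2 * pd s j ψ y * ((G y)⁻¹ k l * G y l i) := by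
    intro l
    rw [hpd, hpd, hpd, hG.conformal_inv hGt hy, hG.symm y hy j l, hG.symm y hy i l]
    linear_combination ((G y)⁻¹ k l * (pd s i (fun z => G z j l) y - 2 * (pd s i ψ y * G y l j)
      + (pd s j (fun z => G z i l) y - 2 * (pd s j ψ y * G y l i))
      - (pd s l (fun z => G z i j) y - 2 * (pd s l ψ y * G y i j)))) * hexp
  simp only [christoffel, hterm, Finset.sum_add_distrib, Finset.sum_sub_distrib, ← Finset.mul_sum,
    hG.sum_inv_mul hy]
  simp only [conformalTensor, grad, mul_ite, mul_one, mul_zero]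
  split_ifs <;> ring

/-- Only the connection term changes, by minus the difference tensor contracted with dw. -/
theorem conformal_hess (hG : IsMetricOn s G) (hψ : ContDiffOn ℝ ∞ ψ s)
    (hGt : ∀ z ∈ s, Gt z = Real.exp (-(2 * ψ z)) • G z) (hy : y ∈ s) (i j : Fin n) :
    hess s Gt w i j y = hess s G w i j y + pd s i ψ y * pd s j w y + pd s j ψ y * pd s i w y
      - G y i j * gradInner s G w ψ y := by
  have h := sum_mul_conformalTensor (g := G y) (p := fun a => pd s a ψ y)
    (P := fun a => grad s G ψ a y) (fun k => pd s k w y) i j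
  rw [← gradInner_eq_sum_grad] at h
  have h' : ∑ k, christoffel s Gt k i j y * pd s k w y = ∑ k, christoffel s G k i j y * pd s k w y
      + ∑ k, pd s k w y * conformalTensor (G y) (fun a => pd s a ψ y)
        (fun a => grad s G ψ a y) k i j := by
    rw [← Finset.sum_add_distrib]
    refine Finset.sum_congr rfl fun k _ => ?_
    rw [hG.conformal_christoffel hψ hGt hy]; ring
  simp only [hess, h', h]
  ring

/-- The Ricci tensor of `e^{-2ψ} g`. -/
theorem conformal_ricci (hG : IsMetricOn s G) (hψ : ContDiffOn ℝ ∞ ψ s)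
    (hGt : ∀ z ∈ s, Gt z = Real.exp (-(2 * ψ z)) • G z) (hy : y ∈ s) (i j : Fin n) :
    ricci s Gt i j y = ricci s G i j y
      + ((n : ℝ) - 2) * (hess s G ψ i j y + pd s i ψ y * pd s j ψ y)
      + (lap s G ψ y - ((n : ℝ) - 2) * gradInner s G ψ ψ y) * G y i j := by
  set D : Fin n → Fin n → Fin n → EuclideanSpace ℝ (Fin n) → ℝ := fun k i j z =>
    conformalTensor (G z) (fun a => pd s a ψ z) (fun a => grad s G ψ a z) k i j with hD
  have hu := hG.uniqueDiffOn
  have hp := contDiffOn_pd hu hψ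
  have hite : ∀ (k a b : Fin n), ContDiffOn ℝ ∞ (fun z => if k = a then pd s b ψ z else 0) s := by
    intro k a b
    split_ifs
    · exact hp b
    · exact contDiffOn_const
  have hGP : ∀ k i j, ContDiffOn ℝ ∞ (fun z => G z i j * grad s G ψ k z) s := fun k i j =>
    (hG.contDiffOn i j).mul (hG.contDiffOn_grad hψ k)
  have hDs : ∀ k i j, ContDiffOn ℝ ∞ (D k i j) s := fun k i j =>
    ((hGP k i j).sub (hite k j i)).sub (hite k i j)
  have hpite : ∀ (c k a b : Fin n), pd s c (fun z => if k = a then pd s b ψ z else 0) y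
      = if k = a then pd s c (pd s b ψ) y else 0 := by
    intro c k a b
    split_ifs
    · rfl
    · exact pd_const 0
  have hΓ : ∀ c k i j, pd s c (christoffel s Gt k i j) y
      = pd s c (christoffel s G k i j) y + pd s c (D k i j) y := by
    intro c k i j
    rw [← pd_add hu (hG.contDiffOn_christoffel k i j) (hDs k i j) hy]
    exact pd_congr (fun z hz => hG.conformal_christoffel hψ hGt hz k i j) hy
  have hsymm := hG.symm y hy
  have hP : ∀ i, ∑ k, G y i k * grad s G ψ k y = pd s i ψ y := hG.sum_mul_grad hy
  -- The divergence of the difference tensor gives -2 ∂_i ∂_j ψ and its trace part gives n ∂_i ∂_j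
  -- ψ, whence the factor n - 2.
  have hdiv : ∑ k, pd s k (D k i j) y = ∑ k, pd s k (fun z => G z i j) y * grad s G ψ k y
      + G y i j * (∑ k, pd s k (grad s G ψ k) y) - pd s j (pd s i ψ) y - pd s i (pd s j ψ) y := by
    have : ∀ k, pd s k (D k i j) y = pd s k (fun z => G z i j) y * grad s G ψ k y
        + G y i j * pd s k (grad s G ψ k) y - (if k = j then pd s k (pd s i ψ) y else 0)
        - (if k = i then pd s k (pd s j ψ) y else 0) := by
      intro k
      rw [hD]
      simp only [conformalTensor]
      rw [pd_sub hu ((hGP k i j).sub (hite k j i)) (hite k i j) hy,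
        pd_sub hu (hGP k i j) (hite k j i) hy, hpite, hpite,
        pd_mul hu (hG.contDiffOn i j) (hG.contDiffOn_grad hψ k) hy]
    simp [this, Finset.sum_sub_distrib, Finset.sum_add_distrib, Finset.mul_sum]
  have htr : ∑ k, pd s j (D k i k) y = -(n * pd s j (pd s i ψ) y) := by
    rw [← pd_sum hu (fun k _ => hDs k i k) hy, pd_congr (w := fun z => (-(n : ℝ)) * pd s i ψ z)
      (fun z hz => by
        rw [hD]
        simp only
        rw [sum_conformalTensor (hG.sum_mul_grad hz)]; ring) hy,
      pd_const_mul hu _ (hp i) hy]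
    ring
  -- By metric compatibility the derivative of g_ij cancels the two lowered-symbol sums in `halg`.
  -- What is left multiplying g_ij, namely ∂_k ∇^k ψ + Γ^k_kl ∇^l ψ, is the Laplacian in divergence
  -- form.
  have hcompat : ∑ k, pd s k (fun z => G z i j) y * grad s G ψ k y
      = ∑ l, (∑ k, G y i k * christoffel s G k j l y) * grad s G ψ l y
        + ∑ l, (∑ k, G y j k * christoffel s G k i l y) * grad s G ψ l y := by
    rw [← Finset.sum_add_distrib]
    refine Finset.sum_congr rfl fun l _ => ?_
    rw [hG.pd_metric hy, ← add_mul, add_comm]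
    congr 2 <;> exact Finset.sum_congr rfl fun k _ => by rw [hG.christoffel_symm hy]
  have halg := sum_christoffel_add_conformalTensor (Γ := fun k i j => christoffel s G k i j y)
    hsymm hP (fun k i j => hG.christoffel_symm hy k i j) i j
  have hsq : ∑ k, ∑ l, (christoffel s Gt k k l y * christoffel s Gt l i j y
        - christoffel s Gt k j l y * christoffel s Gt l i k y)
      = _ := (Finset.sum_congr rfl fun k _ => Finset.sum_congr rfl fun l _ => by
        simp only [hG.conformal_christoffel hψ hGt hy]).trans halg
  rw [← gradInner_eq_sum_grad] at hsq
  have hcomm := pd_comm (i := i) (j := j) hu hG.subset_closure hψ hy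
  rw [ricci, hsq, hG.lap_eq_divergence hψ hy, ricci, hess]
  simp only [hΓ, Finset.sum_sub_distrib, Finset.sum_add_distrib, hdiv, htr, hcompat, hcomm]
  ring

end IsMetricOn
end Geometry
-- The conformal identities and the trace identity
section WeightedConformal

variable {s : Set (EuclideanSpace ℝ (Fin n))}
  {G Gt : EuclideanSpace ℝ (Fin n) → Matrix (Fin n) (Fin n) ℝ}
  {f V u v w ψ : EuclideanSpace ℝ (Fin n) → ℝ} {y : EuclideanSpace ℝ (Fin n)}

theorem pd_exp_neg_mul (hs : UniqueDiffOn ℝ s) (hψ : ContDiffOn ℝ ∞ ψ s)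
    (hv : ContDiffOn ℝ ∞ v s) (hy : y ∈ s) (i : Fin n) :
    pd s i (fun z => Real.exp (-ψ z) * v z) y
      = Real.exp (-ψ y) * (pd s i v y - v y * pd s i ψ y) := by
  have h : pd s i (fun z => -ψ z) y = -pd s i ψ y := by
    rw [pd_congr (w := fun z => (-1) * ψ z) (fun z _ => by ring) hy, pd_const_mul hs _ hψ hy]
    ring
  rw [pd_mul hs hψ.neg.exp hv hy, pd_exp hs hψ.neg hy, h]
  ring

theorem hess_exp_neg_mul (hs : UniqueDiffOn ℝ s) (hψ : ContDiffOn ℝ ∞ ψ s)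
    (hV : ContDiffOn ℝ ∞ V s) (hy : y ∈ s) (i j : Fin n) :
    hess s G (fun z => Real.exp (-ψ z) * V z) i j y
      = Real.exp (-ψ y) * (hess s G V i j y - pd s i ψ y * pd s j V y - pd s j ψ y * pd s i V y
        + V y * (pd s i ψ y * pd s j ψ y) - V y * hess s G ψ i j y) := by
  have hpψ := contDiffOn_pd hs hψ j
  have hpV := contDiffOn_pd hs hV j
  have h2 : pd s i (pd s j (fun z => Real.exp (-ψ z) * V z)) y
      = Real.exp (-ψ y) * (pd s i (pd s j V) y - (pd s i V y * pd s j ψ y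
        + V y * pd s i (pd s j ψ) y) - (pd s j V y - V y * pd s j ψ y) * pd s i ψ y) := by
    rw [pd_congr (fun z hz => pd_exp_neg_mul hs hψ hV hz j) hy,
      pd_exp_neg_mul hs hψ (hpV.sub (hV.mul hpψ)) hy, pd_sub hs hpV (hV.mul hpψ) hy,
      pd_mul hs hV hpψ hy]
  have h3 : ∑ k, christoffel s G k i j y * pd s k (fun z => Real.exp (-ψ z) * V z) y
      = Real.exp (-ψ y) * (∑ k, christoffel s G k i j y * pd s k V y
        - V y * ∑ k, christoffel s G k i j y * pd s k ψ y) := by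
    simp only [pd_exp_neg_mul hs hψ hV hy, Finset.mul_sum, ← Finset.sum_sub_distrib]
    exact Finset.sum_congr rfl fun k _ => by ring
  rw [hess, hess, hess, h2, h3]
  ring

theorem pd_div_const (hs : UniqueDiffOn ℝ s) (hf : ContDiffOn ℝ ∞ f s) (c : ℝ) (hy : y ∈ s)
    (i : Fin n) : pd s i (fun z => f z / c) y = pd s i f y / c := by
  rw [pd_congr (w := fun z => c⁻¹ * f z) (fun z _ => by ring) hy, pd_const_mul hs _ hf hy]
  ring

theorem hess_div_const (hs : UniqueDiffOn ℝ s) (hf : ContDiffOn ℝ ∞ f s) (c : ℝ) (hy : y ∈ s)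
    (i j : Fin n) : hess s G (fun z => f z / c) i j y = hess s G f i j y / c := by
  simp only [hess, pd_congr (fun z hz => pd_div_const hs hf c hz j) hy,
    pd_div_const hs (contDiffOn_pd hs hf j) c hy, pd_div_const hs hf c hy, sub_div,
    Finset.sum_div, mul_div_assoc]

theorem lap_div_const (hs : UniqueDiffOn ℝ s) (hf : ContDiffOn ℝ ∞ f s) (c : ℝ) (hy : y ∈ s) :
    lap s G (fun z => f z / c) y = lap s G f y / c := by
  simp only [lap, tr, hess_div_const hs hf c hy, Finset.sum_div, mul_div_assoc]

theorem gradInner_div_const (hs : UniqueDiffOn ℝ s) (hf : ContDiffOn ℝ ∞ f s) (c : ℝ)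
    (hy : y ∈ s) : gradInner s G v (fun z => f z / c) y = gradInner s G v f y / c := by
  simp only [gradInner, tr, pd_div_const hs hf c hy, Finset.sum_div, mul_div_assoc]

theorem gradInner_div_const_self (hs : UniqueDiffOn ℝ s) (hf : ContDiffOn ℝ ∞ f s) (c : ℝ)
    (hy : y ∈ s) : gradInner s G (fun z => f z / c) (fun z => f z / c) y
      = gradInner s G f f y / c ^ 2 := by
  simp only [gradInner, tr, pd_div_const hs hf c hy, Finset.sum_div]
  exact Finset.sum_congr rfl fun i _ => Finset.sum_congr rfl fun j _ => by ring

theorem gradInner_exp_neg_mul (hs : UniqueDiffOn ℝ s) (hψ : ContDiffOn ℝ ∞ ψ s)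
    (hV : ContDiffOn ℝ ∞ V s) (hy : y ∈ s) :
    gradInner s G (fun z => Real.exp (-ψ z) * V z) w y
      = Real.exp (-ψ y) * (gradInner s G V w y - V y * gradInner s G ψ w y) := by
  simp only [gradInner, tr, pd_exp_neg_mul hs hψ hV hy, Finset.mul_sum, ← Finset.sum_sub_distrib]
  exact Finset.sum_congr rfl fun i _ => Finset.sum_congr rfl fun j _ => by ring

namespace IsMetricOn

/-- The Hessian of `e^{-ψ} V` with respect to `e^{-2ψ} g`. -/
theorem conformal_hess_potential (hG : IsMetricOn s G) (hψ : ContDiffOn ℝ ∞ ψ s)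
    (hV : ContDiffOn ℝ ∞ V s) (hGt : ∀ z ∈ s, Gt z = Real.exp (-(2 * ψ z)) • G z) (hy : y ∈ s)
    (i j : Fin n) :
    hess s Gt (fun z => Real.exp (-ψ z) * V z) i j y
      = Real.exp (-ψ y) * (hess s G V i j y - V y * (hess s G ψ i j y + pd s i ψ y * pd s j ψ y)
        - (gradInner s G V ψ y - V y * gradInner s G ψ ψ y) * G y i j) := by
  have hu := hG.uniqueDiffOn
  -- The mixed terms dψ ⊗ dV from the change of connection cancel those from differentiating e^{-ψ}
  -- twice.
  rw [hG.conformal_hess hψ hGt hy, hess_exp_neg_mul hu hψ hV hy, pd_exp_neg_mul hu hψ hV hy,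
    pd_exp_neg_mul hu hψ hV hy, gradInner_exp_neg_mul hu hψ hV hy]
  ring

/-- The Laplacian of `e^{-ψ} V` with respect to `e^{-2ψ} g`. -/
theorem conformal_lap_potential (hG : IsMetricOn s G) (hψ : ContDiffOn ℝ ∞ ψ s)
    (hV : ContDiffOn ℝ ∞ V s) (hGt : ∀ z ∈ s, Gt z = Real.exp (-(2 * ψ z)) • G z) (hy : y ∈ s) :
    lap s Gt (fun z => Real.exp (-ψ z) * V z) y
      = Real.exp (ψ y) * (lap s G V y - V y * lap s G ψ y - n * gradInner s G V ψ y
        + ((n : ℝ) - 1) * (V y * gradInner s G ψ ψ y)) := by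
  have h : tr G (hess s Gt (fun z => Real.exp (-ψ z) * V z)) y
      = tr G (fun i j z => Real.exp (-ψ z) * (hess s G V i j z
        - V z * (hess s G ψ i j z + pd s i ψ z * pd s j ψ z)
        - (gradInner s G V ψ z - V z * gradInner s G ψ ψ z) * G z i j)) y :=
    tr_congr fun i j => hG.conformal_hess_potential hψ hV hGt hy i j
  have e : Real.exp (2 * ψ y) * Real.exp (-ψ y) = Real.exp (ψ y) := by
    rw [← Real.exp_add]; ring_nf
  rw [lap, hG.conformal_tr hGt hy, h, tr_mul_left, tr_sub, tr_sub, tr_mul_left, tr_add,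
    tr_mul_left, hG.tr_metric hy, ← mul_assoc, e]
  simp only [lap]
  -- The trace of dψ ⊗ dψ is by definition |∇ψ|².
  change _ * (_ - V y * (_ + gradInner s G ψ ψ y) - _) = _
  ring

/-- Adding ½ V S_f removes the curvature from ½ F_f^*(V), so `Sf` can stay folded in the
computation. -/
theorem lap_weightedConformal (hn : (n : ℝ) - 1 ≠ 0) (hG : IsMetricOn s G)
    (hf : ContDiffOn ℝ ∞ f s) (hV : ContDiffOn ℝ ∞ V s)
    (hGt : ∀ z ∈ s, Gt z = Real.exp (-(2 * (f z / ((n : ℝ) - 1)))) • G z) (hy : y ∈ s) :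
    lap s Gt (fun z => Real.exp (-(f z / ((n : ℝ) - 1))) * V z) y
      = Real.exp (f y / ((n : ℝ) - 1)) *
        (1 / 2 * adjF s G f V y + 1 / 2 * V y * Sf s G f y) := by
  have hu := hG.uniqueDiffOn
  rw [hG.conformal_lap_potential (hf.div_const _) hV hGt hy, lap_div_const hu hf _ hy,
    gradInner_div_const hu hf _ hy, gradInner_div_const_self hu hf _ hy, adjF]
  field_simp
  ring

/-- The multiple ½ F_f^*(V) g cancels both the S_f term and the ΔV term of F_g^*(V). The Hessian of
u and the Ricci change contribute 1 + (n - 2) copies of V(∇²ψ + dψ ⊗ dψ), which is V(∇²f + df ⊗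
df/(n-1)). -/
theorem hess_sub_ricci_weightedConformal (hn : (n : ℝ) - 1 ≠ 0) (hG : IsMetricOn s G)
    (hf : ContDiffOn ℝ ∞ f s) (hV : ContDiffOn ℝ ∞ V s)
    (hGt : ∀ z ∈ s, Gt z = Real.exp (-(2 * (f z / ((n : ℝ) - 1)))) • G z) (hy : y ∈ s)
    (i j : Fin n) :
    hess s Gt (fun z => Real.exp (-(f z / ((n : ℝ) - 1))) * V z) i j y
        - Real.exp (-(f y / ((n : ℝ) - 1))) * V y * ricci s Gt i j y
      = Real.exp (-(f y / ((n : ℝ) - 1))) *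
        (adjG s G f V i j y + 1 / 2 * adjF s G f V y * G y i j) := by
  have hu := hG.uniqueDiffOn
  rw [hG.conformal_hess_potential (hf.div_const _) hV hGt hy,
    hG.conformal_ricci (hf.div_const _) hGt hy, lap_div_const hu hf _ hy,
    gradInner_div_const hu hf _ hy, gradInner_div_const_self hu hf _ hy,
    hess_div_const hu hf _ hy, pd_div_const hu hf _ hy, pd_div_const hu hf _ hy, adjF, adjG]
  field_simp
  ring

/-- The trace of `F_g^*(V)` combined with `F_f^*(V)`. -/
theorem tr_adjG_add_adjF (hn : (n : ℝ) - 1 ≠ 0) (hG : IsMetricOn s G) (hy : y ∈ s) :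
    tr G (adjG s G f V) y + ((n : ℝ) - 1) / 2 * adjF s G f V y
      = -(1 / 2) * (V y * Sf s G f y) := by
  have h : tr G (adjG s G f V) y = lap s G V y - lap s G V y * n + gradInner s G V f y * n
      - V y * (scal s G y + lap s G f y + 1 / ((n : ℝ) - 1) * gradInner s G f f y)
      + 1 / 2 * V y * Sf s G f y * n := by
    change tr G (fun i j z => hess s G V i j z - lap s G V z * G z i j
      + gradInner s G V f z * G z i j
      - V z * (ricci s G i j z + hess s G f i j z + 1 / ((n : ℝ) - 1) * (pd s i f z * pd s j f z))
      + 1 / 2 * V z * Sf s G f z * G z i j) y = _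
    rw [tr_add, tr_sub, tr_add, tr_sub, tr_mul_left, tr_mul_left, tr_mul_left, tr_add, tr_add,
      tr_mul_left (fun _ => 1 / ((n : ℝ) - 1)),
      tr_mul_left (fun z => 1 / 2 * V z * Sf s G f z), hG.tr_metric hy]
    rfl
  -- The factor (n-1)/2 cancels ΔV and ⟨∇V, ∇f⟩. The remaining terms assemble to -V S_f, and the
  -- explicit S_f terms add n/2 - (n-1)/2 = 1/2 of V S_f.
  rw [h, adjF, Sf, weightedScal]
  field_simp
  ring

theorem mul_Sf_eq_zero (hn : (n : ℝ) - 1 ≠ 0) (hG : IsMetricOn s G) (hy : y ∈ s)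
    (hg : ∀ i j, adjG s G f V i j y = 0) (hf : adjF s G f V y = 0) : V y * Sf s G f y = 0 := by
  have h := hG.tr_adjG_add_adjF (f := f) (V := V) hn hy
  have h0 : tr G (adjG s G f V) y = 0 := by simp [tr, hg]
  rw [h0, hf] at h
  linarith

end IsMetricOn
end WeightedConformal

/-! ### Unique continuation -/

section UniqueContinuation

variable {s : Set (EuclideanSpace ℝ (Fin n))} {u : EuclideanSpace ℝ (Fin n) → ℝ}
  {y : EuclideanSpace ℝ (Fin n)}

theorem fderivWithin_eq_sum_pd (x : EuclideanSpace ℝ (Fin n)) :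
    fderivWithin ℝ u s y x = ∑ i, x i * pd s i u y := by
  have hx : x = ∑ i, x i • EuclideanSpace.single i (1 : ℝ) := by
    ext j
    simp [Finset.sum_apply, Pi.single_apply]
  conv_lhs => rw [hx]
  simp [pd]

/-- A function satisfying a linear second-order system `∂_i ∂_j u = A^k_ij ∂_k u + B_ij u` with
bounded coefficients on a convex set vanishes identically if its one-jet vanishes at a point. -/
theorem eq_zero_of_hessian_eq (hs : UniqueDiffOn ℝ s) {c : Set (EuclideanSpace ℝ (Fin n))}
    (hcs : c ⊆ s) (hc : Convex ℝ c) (hu : ContDiffOn ℝ ∞ u s)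
    {A : Fin n → Fin n → Fin n → EuclideanSpace ℝ (Fin n) → ℝ}
    {B : Fin n → Fin n → EuclideanSpace ℝ (Fin n) → ℝ}
    (h : ∀ y ∈ c, ∀ i j, pd s i (pd s j u) y = ∑ k, A k i j y * pd s k u y + u y * B i j y)
    {K : ℝ} (hA : ∀ y ∈ c, ∀ k i j, |A k i j y| ≤ K) (hB : ∀ y ∈ c, ∀ i j, |B i j y| ≤ K)
    {y₀ : EuclideanSpace ℝ (Fin n)} (hy₀ : y₀ ∈ c) (h0 : u y₀ = 0)
    (h1 : ∀ i, pd s i u y₀ = 0) {y₁ : EuclideanSpace ℝ (Fin n)} (hy₁ : y₁ ∈ c) : u y₁ = 0 := by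
  set x := y₁ - y₀ with hx
  set γ : ℝ → EuclideanSpace ℝ (Fin n) := fun t => y₀ + t • x with hγ
  have hγc : ∀ t ∈ Set.Icc (0 : ℝ) 1, γ t ∈ c := fun t ht => by
    have := hc.add_smul_sub_mem hy₀ hy₁ ht
    simpa [hγ, hx] using this
  have hγs : Set.MapsTo γ (Set.Icc 0 1) s := fun t ht => hcs (hγc t ht)
  have hγd : ∀ t, HasDerivAt γ x t := fun t => by
    simpa [hγ] using ((hasDerivAt_id t).smul_const x).const_add y₀
  have hder : ∀ w : EuclideanSpace ℝ (Fin n) → ℝ, ContDiffOn ℝ ∞ w s → ∀ t ∈ Set.Icc (0 : ℝ) 1,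
      HasDerivWithinAt (fun τ => w (γ τ)) (∑ i, x i * pd s i w (γ t)) (Set.Icc 0 1) t := by
    intro w hw t ht
    rw [← fderivWithin_eq_sum_pd]
    exact (hw.differentiableWithinAt_of_mem (hγs ht)).hasFDerivWithinAt.comp_hasDerivWithinAt t
      (hγd t).hasDerivWithinAt hγs
  -- The one-jet of `u` along the segment from `y₀` to `y₁`; the system closes it into a linear ODE.
  set F : ℝ → ℝ × (Fin n → ℝ) := fun t => (u (γ t), fun j => pd s j u (γ t)) with hF
  set F' : ℝ → ℝ × (Fin n → ℝ) := fun t =>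
    (∑ i, x i * pd s i u (γ t), fun j => ∑ i, x i * pd s i (pd s j u) (γ t)) with hF'
  have hFd : ∀ t ∈ Set.Icc (0 : ℝ) 1, HasDerivWithinAt F (F' t) (Set.Icc 0 1) t := fun t ht =>
    (hder u hu t ht).prodMk (hasDerivWithinAt_pi.2 fun j => hder _ (contDiffOn_pd hs hu j) t ht)
  set X := ∑ i, |x i| with hX
  have hX0 : 0 ≤ X := Finset.sum_nonneg fun i _ => abs_nonneg _
  set K' := |K| with hK'
  -- `X` bounds the contraction with the direction. The 1 serves the derivative of `u`; the n + 1
  -- counts the n terms in `A` and the one in `B`. `K'` replaces `K`, whose sign is not assumed.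
  have hbound : ∀ t ∈ Set.Ico (0 : ℝ) 1, ‖F' t‖ ≤ (X * (1 + (n + 1) * K')) * ‖F t‖ := by
    intro t ht
    have htc := hγc t (Set.Ico_subset_Icc_self ht)
    have hN := norm_nonneg (F t)
    have hu1 : |u (γ t)| ≤ ‖F t‖ := norm_fst_le (F t)
    have hu2 : ∀ j, |pd s j u (γ t)| ≤ ‖F t‖ := fun j =>
      (norm_le_pi_norm (F t).2 j).trans (norm_snd_le (F t))
    have hsum : ∀ (a : Fin n → ℝ) (L : ℝ), (∀ i, |a i| ≤ L) → |∑ i, x i * a i| ≤ X * L := by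
      intro a L ha
      rw [hX, Finset.sum_mul]
      refine (Finset.abs_sum_le_sum_abs _ _).trans (Finset.sum_le_sum fun i _ => ?_)
      rw [abs_mul]
      exact mul_le_mul_of_nonneg_left (ha i) (abs_nonneg _)
    have hKN : 0 ≤ (n + 1) * K' * ‖F t‖ := by positivity
    have hess_bound : ∀ i j, |pd s i (pd s j u) (γ t)| ≤ (n + 1) * K' * ‖F t‖ := by
      intro i j
      rw [h _ htc i j]
      have hb1 : |∑ k, A k i j (γ t) * pd s k u (γ t)| ≤ n * (K' * ‖F t‖) := by
        refine (Finset.abs_sum_le_sum_abs _ _).trans ?_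
        refine (Finset.sum_le_card_nsmul _ _ (K' * ‖F t‖) fun k _ => ?_).trans (by simp)
        rw [abs_mul]
        exact mul_le_mul ((hA _ htc k i j).trans (le_abs_self K)) (hu2 k) (abs_nonneg _)
          (abs_nonneg _)
      have hb2 : |u (γ t) * B i j (γ t)| ≤ K' * ‖F t‖ := by
        rw [abs_mul, mul_comm]
        exact mul_le_mul ((hB _ htc i j).trans (le_abs_self K)) hu1 (abs_nonneg _) (abs_nonneg _)
      calc _ ≤ _ := abs_add_le _ _
        _ ≤ n * (K' * ‖F t‖) + K' * ‖F t‖ := add_le_add hb1 hb2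
        _ = _ := by ring
    have hle1 : X * ‖F t‖ ≤ X * (1 + (n + 1) * K') * ‖F t‖ := by
      nlinarith [mul_nonneg hX0 hKN]
    have hle2 : X * ((n + 1) * K' * ‖F t‖) ≤ X * (1 + (n + 1) * K') * ‖F t‖ := by
      nlinarith [mul_nonneg hX0 hN]
    refine norm_prod_le_iff.2 ⟨?_, ?_⟩
    · exact (hsum _ _ hu2).trans hle1
    · refine (pi_norm_le_iff_of_nonneg (by positivity)).2 fun j => ?_
      exact (hsum _ _ fun i => hess_bound i j).trans hle2
  have hF0 : F 0 = 0 := by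
    simp [hF, hγ, h0, h1, funext_iff, Prod.ext_iff]
  -- Grönwall's inequality with zero initial value, evaluated at the endpoint t = 1.
  have key := eq_zero_of_abs_deriv_le_mul_abs_self_of_eq_zero_right
    (fun t ht => (hFd t ht).continuousWithinAt)
    (fun t ht => (hFd t (Set.Ico_subset_Icc_self ht)).mono_of_mem_nhdsWithin
      (Icc_mem_nhdsGE_of_mem ht)) hF0 hbound 1 (by simp)
  have := congrArg Prod.fst key
  simpa [hF, hγ, hx] using this

end UniqueContinuation
end CoordGeom

section Charts

variable {n : ℕ} {H : Type*} [TopologicalSpace H]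
  {I : ModelWithCorners ℝ (EuclideanSpace ℝ (Fin n)) H}
  {M : Type*} [TopologicalSpace M] {φ : OpenPartialHomeomorph M H}

/-! ### Metrics and functions read in charts -/

theorem chartDomain_eq (φ : OpenPartialHomeomorph M H) :
    chartDomain I φ = I.symm ⁻¹' φ.target ∩ Set.range I := by
  rw [chartDomain, φ.extend_target]

theorem uniqueDiffOn_chartDomain (φ : OpenPartialHomeomorph M H) :
    UniqueDiffOn ℝ (chartDomain I φ) := by
  rw [chartDomain_eq, Set.inter_comm]
  exact I.uniqueDiffOn.inter (φ.open_target.preimage I.continuous_symm)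

theorem chartDomain_subset_closure_interior (φ : OpenPartialHomeomorph M H) :
    chartDomain I φ ⊆ closure (interior (chartDomain I φ)) := by
  have ho := φ.open_target.preimage I.continuous_symm
  rw [chartDomain_eq, interior_inter, ho.interior_eq]
  exact (Set.inter_subset_inter_right _ I.range_subset_closure_interior).trans
    ho.inter_closure

/-- Carries the density of {V ≠ 0} into a chart, boundary included, where S_f is extended by
continuity. -/
theorem chartDomain_subset_closure_of_dense {S : Set M} (hS : Dense S)
    (φ : OpenPartialHomeomorph M H) :
    chartDomain I φ ⊆ closure {y ∈ chartDomain I φ | (φ.extend I).symm y ∈ S} := by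
  intro y hy
  have hx : (φ.extend I).symm y ∈ φ.source := by simpa using (φ.extend I).map_target hy
  rw [mem_closure_iff]
  intro t ht hyt
  obtain ⟨x', hx', hx'S⟩ := hS.inter_open_nonempty _ (φ.isOpen_extend_preimage (I := I) ht)
    ⟨_, hx, by rwa [Set.mem_preimage, (φ.extend I).right_inv hy]⟩
  refine ⟨φ.extend I x', hx'.2, (φ.extend I).map_source (by rw [φ.extend_source]; exact hx'.1), ?_⟩
  rw [φ.extend_left_inv hx'.1]
  exact hx'S

variable [ChartedSpace H M]

theorem contMDiffOn_chartDomain_symm (hφ : φ ∈ IsManifold.maximalAtlas I ∞ M) :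
    ContMDiffOn 𝓘(ℝ, EuclideanSpace ℝ (Fin n)) I ∞ (φ.extend I).symm (chartDomain I φ) := by
  have := contMDiffOn_extend_symm hφ
  rwa [← φ.extend_target'] at this

theorem contDiffOn_chartFun (hφ : φ ∈ IsManifold.maximalAtlas I ∞ M) {w : M → ℝ}
    (hw : ContMDiff I 𝓘(ℝ, ℝ) ∞ w) : ContDiffOn ℝ ∞ (chartFun I φ w) (chartDomain I φ) :=
  contMDiffOn_iff_contDiffOn.1 (hw.comp_contMDiffOn (contMDiffOn_chartDomain_symm hφ))

theorem contMDiff_conformalPotential (f : C^∞⟮I, M; ℝ⟯) {V : M → ℝ}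
    (hV : ContMDiff I 𝓘(ℝ, ℝ) ∞ V) : ContMDiff I 𝓘(ℝ, ℝ) ∞ (conformalPotential n f V) := by
  have h : ContDiff ℝ ∞ (fun t : ℝ => Real.exp (-(t / ((n : ℝ) - 1)))) := by fun_prop
  exact (h.contMDiff.comp f.contMDiff).mul hV

/-- The derivative of the chart is a left inverse, by the chain rule applied to the identity on the
chart domain. -/
theorem mfderivWithin_chart_symm_injective (hφ : φ ∈ IsManifold.maximalAtlas I ∞ M)
    {y : EuclideanSpace ℝ (Fin n)} (hy : y ∈ chartDomain I φ) :
    Function.Injective (mfderivWithin 𝓘(ℝ, EuclideanSpace ℝ (Fin n)) I (φ.extend I).symm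
      (chartDomain I φ) y) := by
  have hu := (uniqueDiffOn_chartDomain (I := I) φ).uniqueMDiffOn y hy
  have hsrc : (φ.extend I).symm y ∈ φ.source := by
    simpa using (φ.extend I).map_target hy
  have h1 : MDifferentiableAt I 𝓘(ℝ, EuclideanSpace ℝ (Fin n)) (φ.extend I)
      ((φ.extend I).symm y) := (φ.contMDiffAt_extend hφ hsrc).mdifferentiableAt (by simp)
  have h2 := (contMDiffOn_chartDomain_symm hφ).mdifferentiableOn (by simp) y hy
  have h3 := mfderiv_comp_mfderivWithin y h1 h2 hu
  rw [mfderivWithin_eq_fderivWithin] at h3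
  have h4 : fderivWithin ℝ ((φ.extend I) ∘ (φ.extend I).symm) (chartDomain I φ) y
      = ContinuousLinearMap.id ℝ (EuclideanSpace ℝ (Fin n)) := by
    have hid : Set.EqOn ((φ.extend I) ∘ (φ.extend I).symm) id (chartDomain I φ) :=
      fun z hz => (φ.extend I).right_inv hz
    rw [fderivWithin_congr hid (hid hy), fderivWithin_id (uniqueDiffOn_chartDomain φ y hy)]
  have h5 := h4.symm.trans h3
  intro a b hab
  have ha := DFunLike.congr_fun h5 a
  have hb := DFunLike.congr_fun h5 b
  exact ha.trans ((congrArg (mfderiv I 𝓘(ℝ, EuclideanSpace ℝ (Fin n)) (φ.extend I)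
    ((φ.extend I).symm y)) hab).trans hb.symm)

variable [IsManifold I ∞ M]

/-- The coordinate field is the tangent map of the inverse chart applied to a constant section. -/
theorem contMDiffOn_coordVec (hφ : φ ∈ IsManifold.maximalAtlas I ∞ M) (i : Fin n) :
    ContMDiffOn 𝓘(ℝ, EuclideanSpace ℝ (Fin n)) I.tangent ∞
      (fun y => (⟨(φ.extend I).symm y, coordVec I φ i y⟩ : TangentBundle I M))
      (chartDomain I φ) := by
  have h1 := (contMDiffOn_chartDomain_symm hφ).contMDiffOn_tangentMapWithin (m := ∞) (by simp)
    (uniqueDiffOn_chartDomain φ).uniqueMDiffOn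
  have h2 : ContMDiffOn 𝓘(ℝ, EuclideanSpace ℝ (Fin n)) 𝓘(ℝ, EuclideanSpace ℝ (Fin n)).tangent ∞
      (fun y => (⟨y, EuclideanSpace.single i (1 : ℝ)⟩ :
        TangentBundle 𝓘(ℝ, EuclideanSpace ℝ (Fin n)) (EuclideanSpace ℝ (Fin n))))
      (chartDomain I φ) :=
    contMDiffOn_vectorSpace_iff_contDiffOn.2 contDiffOn_const
  exact h1.comp h2 fun y hy => hy

theorem contDiffOn_chartMetric (hφ : φ ∈ IsManifold.maximalAtlas I ∞ M) (g : RiemMetric I M)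
    (i j : Fin n) :
    ContDiffOn ℝ ∞ (fun y => chartMetric g φ y i j) (chartDomain I φ) := by
  have h : ContMDiffOn 𝓘(ℝ, EuclideanSpace ℝ (Fin n)) (I.prod 𝓘(ℝ, ℝ)) ∞
      (fun y => TotalSpace.mk' ℝ (E := Bundle.Trivial M ℝ) ((φ.extend I).symm y)
        (g.inner ((φ.extend I).symm y) (coordVec I φ i y) (coordVec I φ j y)))
      (chartDomain I φ) := by
    apply ContMDiffOn.clm_bundle_apply₂ (F₁ := EuclideanSpace ℝ (Fin n))
      (F₂ := EuclideanSpace ℝ (Fin n))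
    · exact g.contMDiff.comp_contMDiffOn (contMDiffOn_chartDomain_symm hφ)
    · exact contMDiffOn_coordVec hφ i
    · exact contMDiffOn_coordVec hφ j
  rw [← contMDiffOn_iff_contDiffOn]
  intro y hy
  have := h y hy
  simp only [contMDiffWithinAt_totalSpace] at this
  exact this.2

/-- A kernel vector c makes ∑ c_i ∂_i a vector of zero length, hence zero by positivity; injectivity
of the inverse chart's derivative then gives c = 0. -/
theorem isUnit_det_chartMetric (hφ : φ ∈ IsManifold.maximalAtlas I ∞ M) (g : RiemMetric I M)
    {y : EuclideanSpace ℝ (Fin n)} (hy : y ∈ chartDomain I φ) :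
    IsUnit (chartMetric g φ y).det := by
  rw [isUnit_iff_ne_zero]
  intro h
  obtain ⟨c, hc, hc0⟩ := Matrix.exists_mulVec_eq_zero_iff.2 h
  set L := mfderivWithin 𝓘(ℝ, EuclideanSpace ℝ (Fin n)) I (φ.extend I).symm
      (chartDomain I φ) y with hL
  set x : EuclideanSpace ℝ (Fin n) := ∑ i, c i • EuclideanSpace.single i (1 : ℝ) with hx
  have hLx : L x = ∑ i, c i • coordVec I φ i y := by
    rw [hx]
    exact (map_sum L _ _).trans (Finset.sum_congr rfl fun i _ => map_smul L _ _)
  have hq : g.inner ((φ.extend I).symm y) (L x) (L x) = 0 := by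
    have : c ⬝ᵥ (chartMetric g φ y).mulVec c = 0 := by rw [hc0, dotProduct_zero]
    rw [hLx]
    simp only [map_sum, map_smul, sum_apply, smul_apply,
      smul_eq_mul, Finset.mul_sum]
    simp only [dotProduct, Matrix.mulVec, chartMetric, Matrix.of_apply, Finset.mul_sum] at this
    rw [← this, Finset.sum_comm]
    exact Finset.sum_congr rfl fun i _ => Finset.sum_congr rfl fun j _ => by ring
  have hLx0 : L x = 0 := by
    by_contra hne
    exact (g.pos _ _ hne).ne' hq
  have hx0 : x = 0 := mfderivWithin_chart_symm_injective hφ hy (hLx0.trans (map_zero L).symm)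
  refine hc (funext fun i => ?_)
  have := congrArg (fun v : EuclideanSpace ℝ (Fin n) => v i) hx0
  simpa [hx, Finset.sum_apply, Pi.single_apply] using this

/-- The matrix of a Riemannian metric in a chart is a metric on the coordinate domain. -/
theorem isMetricOn_chartMetric (hφ : φ ∈ IsManifold.maximalAtlas I ∞ M) (g : RiemMetric I M) :
    CoordGeom.IsMetricOn (chartDomain I φ) (chartMetric g φ) where
  uniqueDiffOn := uniqueDiffOn_chartDomain φ
  subset_closure := chartDomain_subset_closure_interior φ
  contDiffOn := contDiffOn_chartMetric hφ g
  symm _ _ _ _ := g.symm _ _ _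
  isUnit_det _ hy := isUnit_det_chartMetric hφ g hy

theorem chartMetric_weightedConformal (g : RiemMetric I M) (f : C^∞⟮I, M; ℝ⟯)
    (φ : OpenPartialHomeomorph M H) (y : EuclideanSpace ℝ (Fin n)) :
    chartMetric (weightedConformal g f) φ y
      = Real.exp (-(2 * (chartFun I φ f y / ((n : ℝ) - 1)))) • chartMetric g φ y := by
  rw [← mul_div_assoc]
  rfl

end Charts

section StaticVacuum

open Filter Topology

variable {n : ℕ} {H : Type*} [TopologicalSpace H]
  {I : ModelWithCorners ℝ (EuclideanSpace ℝ (Fin n)) H}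
  {M : Type*} [TopologicalSpace M] [ChartedSpace H M] [IsManifold I ∞ M]

/-! ### Static potentials do not vanish on open sets -/

/-- A solution of `∇² u = u Ric` that vanishes on open sets accumulating at a point vanishes near
that point. -/
theorem mem_interior_zeroSet_of_hess_eq (g : RiemMetric I M) {u : M → ℝ}
    (hu : ContMDiff I 𝓘(ℝ, ℝ) ∞ u)
    (h : ∀ φ ∈ IsManifold.maximalAtlas I ∞ M, ∀ y ∈ chartDomain I φ, ∀ i j,
      CoordGeom.hess (chartDomain I φ) (chartMetric g φ) (chartFun I φ u) i j y
        = chartFun I φ u y * CoordGeom.ricci (chartDomain I φ) (chartMetric g φ) i j y)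
    {x : M} (hx : x ∈ closure (interior {z | u z = 0})) : x ∈ interior {z | u z = 0} := by
  set φ := chartAt H x with hφ_def
  have hφ : φ ∈ IsManifold.maximalAtlas I ∞ M := IsManifold.chart_mem_maximalAtlas x
  have hG := isMetricOn_chartMetric hφ g
  have hw := contDiffOn_chartFun hφ hu
  set s := chartDomain I φ with hs
  set G := chartMetric g φ with hG_def
  set y := φ.extend I x with hy_def
  have hxs : x ∈ φ.source := mem_chart_source H x
  have hys : y ∈ s := (φ.extend I).map_source (by rwa [φ.extend_source])
  -- One continuous function dominating every coefficient of the system; near `y` it stays below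
  -- b(y) + 1, which serves as the constant `K`.
  set b : EuclideanSpace ℝ (Fin n) → ℝ := fun z =>
    ∑ p : Fin n × Fin n × Fin n, |CoordGeom.christoffel s G p.1 p.2.1 p.2.2 z|
      + ∑ p : Fin n × Fin n, |CoordGeom.ricci s G p.1 p.2 z|
    with hb_def
  have hb : ContinuousOn b s :=
    (continuousOn_finsetSum _ fun p _ => (hG.contDiffOn_christoffel _ _ _).continuousOn.abs).add
    (continuousOn_finsetSum _ fun p _ => (hG.contDiffOn_ricci _ _).continuousOn.abs)
  have hev : ∀ᶠ z in 𝓝[Set.range I] y, z ∈ s ∧ b z < b y + 1 := by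
    rw [← φ.nhdsWithin_extend_target_eq hxs]
    exact eventually_mem_nhdsWithin.and ((hb y hys).eventually_lt_const (lt_add_one _))
  obtain ⟨ε, hε, hball⟩ := Metric.mem_nhdsWithin_iff.1 hev
  have hN : IsOpen (φ.source ∩ φ.extend I ⁻¹' Metric.ball y ε) :=
    φ.isOpen_extend_preimage Metric.isOpen_ball
  have hxN : x ∈ φ.source ∩ φ.extend I ⁻¹' Metric.ball y ε := ⟨hxs, Metric.mem_ball_self hε⟩
  have hmem : ∀ z ∈ φ.source ∩ φ.extend I ⁻¹' Metric.ball y ε,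
      φ.extend I z ∈ Metric.ball y ε ∩ Set.range I := fun z hz => ⟨hz.2, by simp⟩
  have hfun : ∀ z ∈ φ.source, chartFun I φ u (φ.extend I z) = u z := fun z hz => by
    rw [chartFun, φ.extend_left_inv hz]
  -- `u` vanishes near `x'`, so its one-jet vanishes there. Every point of the neighbourhood is
  -- joined to `x'` by a segment in the ball intersected with the convex range of the model.
  obtain ⟨x', hx'N, hx'Z⟩ := mem_closure_iff.1 hx _ hN hxN
  have hx's : φ.extend I x' ∈ s := (hball (hmem x' hx'N)).1
  have hzero : chartFun I φ u =ᶠ[𝓝[s] (φ.extend I x')] fun _ => 0 := by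
    have hc := (φ.continuousAt_extend_symm (I := I) hx'N.1).tendsto
    rw [φ.extend_left_inv hx'N.1] at hc
    exact nhdsWithin_le_nhds (hc (mem_interior_iff_mem_nhds.1 hx'Z))
  have hu0 : chartFun I φ u (φ.extend I x') = 0 := by
    rw [hfun x' hx'N.1]; exact interior_subset (s := {z | u z = 0}) hx'Z
  have hcoef : ∀ z ∈ Metric.ball y ε ∩ Set.range I, (∀ k i j,
      |CoordGeom.christoffel s G k i j z| ≤ b y + 1) ∧
      ∀ i j, |CoordGeom.ricci s G i j z| ≤ b y + 1 := by
    intro z hz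
    have hbz := (hball hz).2.le
    have h1 := Finset.sum_nonneg (s := Finset.univ) fun (p : Fin n × Fin n × Fin n) _ =>
      abs_nonneg (CoordGeom.christoffel s G p.1 p.2.1 p.2.2 z)
    have h2 := Finset.sum_nonneg (s := Finset.univ) fun (p : Fin n × Fin n) _ =>
      abs_nonneg (CoordGeom.ricci s G p.1 p.2 z)
    refine ⟨fun k i j => ?_, fun i j => ?_⟩
    · exact (Finset.single_le_sum (f := fun p : Fin n × Fin n × Fin n =>
        |CoordGeom.christoffel s G p.1 p.2.1 p.2.2 z|) (fun _ _ => abs_nonneg _)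
        (Finset.mem_univ (k, i, j))).trans ((le_add_of_nonneg_right h2).trans hbz)
    · exact (Finset.single_le_sum (f := fun p : Fin n × Fin n =>
        |CoordGeom.ricci s G p.1 p.2 z|) (fun _ _ => abs_nonneg _)
        (Finset.mem_univ (i, j))).trans ((le_add_of_nonneg_left h1).trans hbz)
  refine mem_interior.2 ⟨_, fun z hz => ?_, hN, hxN⟩
  rw [Set.mem_ofPred_eq, ← hfun z hz.1]
  refine CoordGeom.eq_zero_of_hessian_eq hG.uniqueDiffOn (fun z hz => (hball hz).1)
    ((convex_ball y ε).inter I.convex_range) hw (fun z hz i j => ?_)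
    (fun z hz => (hcoef z hz).1) (fun z hz => (hcoef z hz).2) (hmem x' hx'N) hu0 (fun i => ?_)
    (hmem z hz)
  · have := h φ hφ z (hball hz).1 i j
    rw [CoordGeom.hess] at this
    linarith
  · rw [CoordGeom.pd, hzero.fderivWithin_eq hu0]
    simp

/-- A static potential is nonzero on a dense set. -/
theorem IsStaticVacuum.dense_ne_zero [PreconnectedSpace M] {g : RiemMetric I M} {u : M → ℝ}
    (h : IsStaticVacuum g u) : Dense {x | u x ≠ 0} := by
  obtain ⟨hu, ⟨x, hx⟩, heq⟩ := h
  have hclopen : IsClopen (interior {z | u z = 0}) :=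
    ⟨isClosed_of_closure_subset fun x hx => mem_interior_zeroSet_of_hess_eq g hu
      (fun φ hφ y hy => (heq φ hφ y hy).1) hx, isOpen_interior⟩
  rcases isClopen_iff.1 hclopen with h0 | h1
  · exact interior_eq_empty_iff_dense_compl.1 h0
  · exact absurd (interior_subset (s := {z | u z = 0}) (h1.symm ▸ Set.mem_univ x)) hx

end StaticVacuum

/-! ### The main theorem -/

theorem mainTheorem4 {n : ℕ} (hn : 3 ≤ n) {H : Type*} [TopologicalSpace H]
    (I : ModelWithCorners ℝ (EuclideanSpace ℝ (Fin n)) H)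
    {M : Type*} [TopologicalSpace M] [ChartedSpace H M] [IsManifold I ∞ M] [ConnectedSpace M]
    (g : RiemMetric I M) (f : C^∞⟮I, M; ℝ⟯) :
    -- the conformal identities, for every smooth function `V`
    (∀ V : M → ℝ, ContMDiff I 𝓘(ℝ, ℝ) ∞ V →
      ∀ φ ∈ IsManifold.maximalAtlas I ∞ M, ∀ y ∈ chartDomain I φ,
        CoordGeom.lap (chartDomain I φ) (chartMetric (weightedConformal g f) φ)
            (chartFun I φ (conformalPotential n f V)) y
          = Real.exp (chartFun I φ f y / ((n : ℝ) - 1)) *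
            (1 / 2 * CoordGeom.adjF (chartDomain I φ) (chartMetric g φ)
                (chartFun I φ f) (chartFun I φ V) y
              + 1 / 2 * chartFun I φ V y * CoordGeom.Sf (chartDomain I φ) (chartMetric g φ)
                (chartFun I φ f) y) ∧
        ∀ i j,
          CoordGeom.hess (chartDomain I φ) (chartMetric (weightedConformal g f) φ)
              (chartFun I φ (conformalPotential n f V)) i j y
            - chartFun I φ (conformalPotential n f V) y *
              CoordGeom.ricci (chartDomain I φ) (chartMetric (weightedConformal g f) φ) i j y
          = Real.exp (-(chartFun I φ f y / ((n : ℝ) - 1))) *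
            (CoordGeom.adjG (chartDomain I φ) (chartMetric g φ)
                (chartFun I φ f) (chartFun I φ V) i j y
              + 1 / 2 * CoordGeom.adjF (chartDomain I φ) (chartMetric g φ)
                (chartFun I φ f) (chartFun I φ V) y * chartMetric g φ y i j)) ∧
    -- an `f`-static potential gives a static vacuum metric, and `S_f ≡ 0`
    (∀ V : M → ℝ, IsFStaticPotential g f V →
      IsStaticVacuum (weightedConformal g f) (conformalPotential n f V) ∧
      ∀ φ ∈ IsManifold.maximalAtlas I ∞ M, ∀ y ∈ chartDomain I φ,
        CoordGeom.Sf (chartDomain I φ) (chartMetric g φ) (chartFun I φ f) y = 0) := by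
  have hn1 : (n : ℝ) - 1 ≠ 0 := by
    have : (3 : ℝ) ≤ n := by exact_mod_cast hn
    linarith
  have hlap : ∀ V : M → ℝ, ContMDiff I 𝓘(ℝ, ℝ) ∞ V →
      ∀ φ ∈ IsManifold.maximalAtlas I ∞ M, ∀ y ∈ chartDomain I φ, _ := fun V hV φ hφ y hy =>
    (isMetricOn_chartMetric hφ g).lap_weightedConformal hn1
      (contDiffOn_chartFun hφ f.contMDiff) (contDiffOn_chartFun hφ hV)
      (fun z _ => chartMetric_weightedConformal g f φ z) hy
  have hhess : ∀ V : M → ℝ, ContMDiff I 𝓘(ℝ, ℝ) ∞ V →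
      ∀ φ ∈ IsManifold.maximalAtlas I ∞ M, ∀ y ∈ chartDomain I φ, ∀ i j, _ :=
    fun V hV φ hφ y hy i j =>
    (isMetricOn_chartMetric hφ g).hess_sub_ricci_weightedConformal hn1
      (contDiffOn_chartFun hφ f.contMDiff) (contDiffOn_chartFun hφ hV)
      (fun z _ => chartMetric_weightedConformal g f φ z) hy i j
  refine ⟨fun V hV φ hφ y hy => ⟨hlap V hV φ hφ y hy, hhess V hV φ hφ y hy⟩, ?_⟩
  rintro V ⟨hV, ⟨x, hx⟩, heq⟩
  -- Needed before the static equations: F_f^*(V) = 0 alone leaves the multiple ½ V S_f in the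
  -- Laplacian of u.
  have hVS : ∀ φ ∈ IsManifold.maximalAtlas I ∞ M, ∀ y ∈ chartDomain I φ,
      chartFun I φ V y * CoordGeom.Sf (chartDomain I φ) (chartMetric g φ) (chartFun I φ f) y = 0 :=
    fun φ hφ y hy => (isMetricOn_chartMetric hφ g).mul_Sf_eq_zero hn1 hy
      (heq φ hφ y hy).1 (heq φ hφ y hy).2
  have hstatic : IsStaticVacuum (weightedConformal g f) (conformalPotential n f V) := by
    refine ⟨contMDiff_conformalPotential f hV, ⟨x, mul_ne_zero (Real.exp_ne_zero _) hx⟩,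
      fun φ hφ y hy => ⟨fun i j => ?_, ?_⟩⟩
    · have h := hhess V hV φ hφ y hy i j
      rw [(heq φ hφ y hy).1 i j, (heq φ hφ y hy).2] at h
      rw [← sub_eq_zero]
      refine Eq.trans h ?_
      ring
    · refine (hlap V hV φ hφ y hy).trans ?_
      rw [(heq φ hφ y hy).2, mul_assoc, hVS φ hφ y hy]
      ring
  refine ⟨hstatic, fun φ hφ => ?_⟩
  have hdense : Dense {x | V x ≠ 0} :=
    hstatic.dense_ne_zero.mono fun x hx => right_ne_zero_of_mul hx
  have hSf := (isMetricOn_chartMetric hφ g).contDiffOn_Sf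
    (contDiffOn_chartFun hφ f.contMDiff)
  -- S_f vanishes wherever V does not, and that set is dense in the chart domain.
  exact Set.EqOn.of_subset_closure
    (fun y hy => (mul_eq_zero.1 (hVS φ hφ y hy.1)).resolve_left hy.2)
    hSf.continuousOn continuousOn_const (fun y hy => hy.1)
    (chartDomain_subset_closure_of_dense hdense φ)
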